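/- **Market.** Let $\mathcal N=\{1,\dots,n\}$ be a set of nodes and $\mathcal E\subseteq \mathcal N\times\mathcal N$ a set of lanes (self-loops allowed). For each lane $(i,j)\in\mathcal E$ there are given: a set $R_{ij}\subseteq\mathbb R$ of admissible shipper prices and a demand function $d_{ij}$ that is nonnegative and strictly decreasing on $R_{ij}$, with inverse $r_{ij}(\cdot):d_{ij}(R_{ij})\to R_{ij}$; a carrier arrival rate $\lambda_{ij}>0$; a probability $q_{ij}\ge 0$, with $\sum_{k:(j,k)\in\mathcal E}q_{jk}\le 1$ for every node $j$; a unit penalty $b_{ij}\in\mathbb R$; and the law of a carrier's opportunity cost, which lives on $[0,\infty)$, has a density, and whose distribution function $F_{ij}$ is strictly increasing where $0<F_{ij}<1$, with inverse $F_{ij}^{-1}$, understood as the quantile function $F_{ij}^{-1}(x)=\inf\{c\ge 0:F_{ij}(c)\ge x\}$. **Fluid problem** ($\mathsf{FA}$). Maximize $$\sum_{(i,j)\in\mathcal E} r_{ij}(d_{ij})d_{ij}-F_{ij}^{-1}\!\left(\frac{\bar y_{ij}}{\bar\lambda_{ij}}\right)\bar y_{ij}-b_{ij}(d_{ij}-\bar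 y_{ij})$$ over $(\mathbf d,\bar{\mathbf y},\bar{\boldsymbol\lambda})\ge 0$ subject to $\sum_{k:(k,i)\in\mathcal E}q_{ij}\bar y_{ki}+\lambda_{ij}=\bar\lambda_{ij}$, $\bar y_{ij}\le d_{ij}$ and $\bar y_{ij}\le\bar\lambda_{ij}$ for all $(i,j)\in\mathcal E$, where $d_{ij}$ has to be in the range of the demand function, $d_{ij}\in d_{ij}(R_{ij})$, and $\bar y_{ij}/\bar\lambda_{ij}$ in the range of $F_{ij}$. For $\theta\in\{1,2,\dots\}$, the $\theta$-scaled market has demand functions $\theta d_{ij}(\cdot)$ and arrival rates $\theta\lambda_{ij}$, all other data being unchanged; $\gamma^{\mathsf{FA}}(\theta)$ denotes the optimal value of its fluid problem. Assume that the fluid problem with $\theta=1$ has an optimal solution $(\mathbf d^*,\bar{\mathbf y}^*,\bar{\boldsymbol\lambda}^*)$ and that its optimal value is positive. **Static posted prices** ($\mathsf{SP}$). Let $r^*_{ij}=r_{ij}(d^*_{ij})$ and $p^*_{ij}=F_{ij}^{-1}(\bar y^*_{ij}/\bar\lambda^*_{ij})$. In the $\theta$-scaled market under $\mathsf{SP}$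 the state $(\mathbf S_t,\mathbf D_t)$ (numbers of available carriers and of loads on each lane) is the following Markov chain. Each of the $S_{ijt}$ carriers on lane $(i,j)$ draws an independent opportunity cost from the law $F_{ij}$ and wants to book iff it is at most $p^*_{ij}$; let $X_{ijt}$ be the number of these carriers and $Y_{ijt}=\min(X_{ijt},D_{ijt})$ the number of loads transported. Each carrier who has transported a load to node $j$ becomes, independently, available on lane $(j,k)$ with probability $q_{jk}$ and leaves otherwise; all other carriers leave. With $Z_{ijt}$ the number of carriers who so become available on lane $(i,j)$, $S_{ij,t+1}=Z_{ijt}+\Lambda_{ij,t+1}$, where the $\Lambda_{ij,t+1}\sim\mathrm{Poisson}(\theta\lambda_{ij})$ and $D_{ij,t+1}\sim\mathrm{Poisson}(\theta d_{ij}(r^*_{ij}))$ are independent of each other and of the past. The expected profit of period $t$ is $$G(\mathbf S_t,\mathbf D_t)=\mathrm E\Big[\sum_{(i,j)\in\mathcal E}\theta r^*_{ij}d_{ij}(r^*_{ij})-b_{ij}(D_{ijt}-Y_{ijt})-p^*_{ij}Y_{ijt}\,\Big|\,\mathbf S_t,\mathbf D_t\Big].$$ **Theorem.** For every $\theta\in\{1,2,\dots\}$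 the long-run average profit $\gamma^{\mathsf{SP}}(\theta)=\lim_{T\to\infty}\frac1T\sum_{t=1}^T\mathrm E[G(\mathbf S_t,\mathbf D_t)]$ exists and is the same for all initial states. There is a constant $C$, independent of $\theta$, such that $$\gamma^{\mathsf{FA}}(\theta)-\gamma^{\mathsf{SP}}(\theta)\le C\sqrt\theta\qquad\text{for all }\theta\in\{1,2,\dots\},$$ and $\gamma^{\mathsf{SP}}(\theta)/\gamma^{\mathsf{FA}}(\theta)=1-O(1/\sqrt\theta)\to 1$ as $\theta\to\infty$. -/

import Mathlib

open MeasureTheory ProbabilityTheory Filter Topology Asymptotics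

noncomputable section

/-- The primitives of a freight marketplace on a network with nodes `Fin n` and set of lanes
(origin-destination arcs, self-loops allowed) `E`. -/
structure FreightMarket {n : ℕ} (E : Finset (Fin n × Fin n)) where
  /-- admissible shipper prices on each lane -/
  priceSet : E → Set ℝ
  /-- demand rate on a lane as a function of the shipper price -/
  demand : E → ℝ → ℝ
  /-- rate of exogenous carrier arrivals -/
  arrival : E → ℝ
  /-- `stay (j,k)` is the probability that a carrier who has just delivered a load to node `j`
  stays in the marketplace and is available on lane `(j,k)` in the next period -/
  stay : E → ℝ
  /-- penalty per unmatched load -/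
  penalty : E → ℝ
  /-- law of a carrier's opportunity cost -/
  costLaw : E → Measure ℝ

/-- A candidate `(d, ȳ, λ̄)` of the fluid problem. -/
structure FluidPoint {n : ℕ} (E : Finset (Fin n × Fin n)) where
  d : E → ℝ
  y : E → ℝ
  lam : E → ℝ

/-- A system state `(S, D)`: available carriers and loads on each lane. -/
abbrev FreightState {n : ℕ} (E : Finset (Fin n × Fin n)) : Type := (E → ℕ) × (E → ℕ)

namespace FreightMarket

variable {n : ℕ} {E : Finset (Fin n × Fin n)} (M : FreightMarket E)

/-- The cumulative distribution function `F` of the opportunity cost. -/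
def costCDF (e : E) (c : ℝ) : ℝ := cdf (M.costLaw e) c

/-- `F⁻¹`, as the quantile function on the nonnegative half line (costs are nonnegative). -/
def costQuantile (e : E) (x : ℝ) : ℝ := sInf {c : ℝ | 0 ≤ c ∧ x ≤ M.costCDF e c}

/-- The inverse demand function `r_e(d)`. -/
def invDemand (e : E) (d : ℝ) : ℝ := Function.invFunOn (M.demand e) (M.priceSet e) d

/-- Standing assumptions on the primitives. -/
structure IsRegular : Prop where
  demand_nonneg : ∀ e, ∀ r ∈ M.priceSet e, 0 ≤ M.demand e r
  demand_strictAnti : ∀ e, StrictAntiOn (M.demand e) (M.priceSet e)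
  arrival_pos : ∀ e, 0 < M.arrival e
  stay_nonneg : ∀ e, 0 ≤ M.stay e
  stay_sum_le_one : ∀ j : Fin n, ∑ e : E with e.1.1 = j, M.stay e ≤ 1
  cost_prob : ∀ e, IsProbabilityMeasure (M.costLaw e)
  cost_nonneg : ∀ e, M.costLaw e (Set.Iio 0) = 0
  cost_density : ∀ e, M.costLaw e ≪ volume
  cost_strictMono : ∀ e,
    StrictMonoOn (M.costCDF e) {c | 0 < M.costCDF e c ∧ M.costCDF e c < 1}

/-- The market in which demand rates and carrier arrival rates are multiplied by `θ`. -/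
def scale (θ : ℝ) : FreightMarket E :=
  { M with
    demand := fun e r => θ * M.demand e r
    arrival := fun e => θ * M.arrival e }

/-! ### The fluid problem -/

/-- The constraints of the fluid problem. The two membership conditions say that the prices
`r_e(d_e)` and `F_e⁻¹(ȳ_e / λ̄_e)` occurring in the objective exist. -/
structure FluidFeasible (z : FluidPoint E) : Prop where
  flow : ∀ e : E, (∑ k : E with k.1.2 = e.1.1, M.stay e * z.y k) + M.arrival e = z.lam e
  y_le_d : ∀ e, z.y e ≤ z.d e
  y_le_lam : ∀ e, z.y e ≤ z.lam e
  y_nonneg : ∀ e, 0 ≤ z.y e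
  lam_nonneg : ∀ e, 0 ≤ z.lam e
  d_nonneg : ∀ e, 0 ≤ z.d e
  d_mem : ∀ e, z.d e ∈ M.demand e '' M.priceSet e
  ratio_mem : ∀ e, z.y e / z.lam e ∈ Set.range (M.costCDF e)

/-- The objective of the fluid problem. -/
def fluidObjective (z : FluidPoint E) : ℝ :=
  ∑ e, (M.invDemand e (z.d e) * z.d e
    - M.costQuantile e (z.y e / z.lam e) * z.y e
    - M.penalty e * (z.d e - z.y e))

/-- `z` is an optimal solution of the fluid problem. -/
def IsFluidOptimal (z : FluidPoint E) : Prop :=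
  M.FluidFeasible z ∧ ∀ z', M.FluidFeasible z' → M.fluidObjective z' ≤ M.fluidObjective z

/-- The optimal value `γ^FA` of the fluid problem. -/
def fluidValue : ℝ := sSup (M.fluidObjective '' {z | M.FluidFeasible z})

/-- Shipper prices `r*` read off from a fluid solution. -/
def shipperPrice (z : FluidPoint E) (e : E) : ℝ := M.invDemand e (z.d e)

/-- Carrier payments `p*` read off from a fluid solution. -/
def carrierPrice (z : FluidPoint E) (e : E) : ℝ := M.costQuantile e (z.y e / z.lam e)

/-! ### The Markov chain under static posted prices `r` (shippers) and `p` (carriers) -/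

/-- Law of the number `X` of carriers who want to book on each lane: the carriers have independent
opportunity costs, and a carrier wants to book iff his cost is at most the posted price. -/
def bookingLaw (p : E → ℝ) (S : E → ℕ) : Measure (E → ℕ) :=
  (Measure.pi fun s : (Σ e : E, Fin (S e)) => M.costLaw s.1).map
    fun c e => Fintype.card {s : Fin (S e) // c ⟨e, s⟩ ≤ p e}

/-- The number `Y = min (X, D)` of loads transported on each lane. -/
def shipped (X D : E → ℕ) (e : E) : ℕ := min (X e) (D e)

/-- Next move of one carrier who has just arrived loaded at node `j`: a unit vector for the lane
out of `j` on which he becomes available, or `0` if he leaves the marketplace. -/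
def routeLaw (j : Fin n) : Measure (E → ℕ) :=
  (∑ e : E with e.1.1 = j, ENNReal.ofReal (M.stay e) • Measure.dirac (Pi.single e 1)) +
    ENNReal.ofReal (1 - ∑ e : E with e.1.1 = j, M.stay e) • Measure.dirac 0

/-- Law of the numbers `Z` of returning carriers, given the numbers `Y` of transported loads:
the carriers move independently, so that `(Z_{jk})_k` is multinomial for each node `j`. -/
def returnLaw (Y : E → ℕ) : Measure (E → ℕ) :=
  (Measure.pi fun s : (Σ e : E, Fin (Y e)) => M.routeLaw s.1.1.2).map fun v => ∑ s, v s

/-- Law of the exogenous carrier arrivals `Λ`: independent Poisson variables. -/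
def arrivalLaw : Measure (E → ℕ) :=
  Measure.pi fun e => poissonMeasure (M.arrival e).toNNReal

/-- Law of the new loads under shipper prices `r`: independent Poisson variables. -/
def demandLaw (r : E → ℝ) : Measure (E → ℕ) :=
  Measure.pi fun e => poissonMeasure (M.demand e (r e)).toNNReal

/-- One-step transition law from a state `(S, D)`: the next state is `(Z + Λ, D')`. -/
def stepLaw (r p : E → ℝ) (σ : FreightState E) : Measure (FreightState E) :=
  (M.bookingLaw p σ.1).bind fun X =>
    (((M.returnLaw (shipped X σ.2)).prod M.arrivalLaw).map fun w => w.1 + w.2).prod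
      (M.demandLaw r)

/-- Law of the state after `t` transitions from the initial state `σ`. -/
def stateLaw (r p : E → ℝ) (σ : FreightState E) : ℕ → Measure (FreightState E)
  | 0 => Measure.dirac σ
  | t + 1 => (stateLaw r p σ t).bind (M.stepLaw r p)

/-- Expected one-period profit `G(S, D)`. -/
def expectedProfit (r p : E → ℝ) (σ : FreightState E) : ℝ :=
  ∫ X, ∑ e, (r e * M.demand e (r e)
      - M.penalty e * ((σ.2 e : ℝ) - (shipped X σ.2 e : ℝ))
      - p e * (shipped X σ.2 e : ℝ)) ∂(M.bookingLaw p σ.1)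

/-- `γ` is the long-run average profit per period under static prices `(r, p)`: whatever the
initial state, `(1/T) ∑_{t ≤ T} E[G(S_t, D_t)]` is well defined and converges to `γ`. -/
def IsLongRunAverageProfit (r p : E → ℝ) (γ : ℝ) : Prop :=
  ∀ σ : FreightState E,
    (∀ t, Integrable (M.expectedProfit r p) (M.stateLaw r p σ t)) ∧
    Tendsto (fun T : ℕ =>
        (∑ t ∈ Finset.range T, ∫ τ, M.expectedProfit r p τ ∂(M.stateLaw r p σ t)) / (T : ℝ))
      atTop (𝓝 γ)

end FreightMarket

end

/-!
When no load arrives anywhere, the next state no longer depends on the carriers; this gives a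
Doeblin minorization, so the expected numbers of transported loads converge to a throughput `u`
that does not depend on the initial state. Started from the empty market, the carriers on a lane
have a factorial moment generating function dominated by that of a Poisson variable whose mean is
the fluid value `θ λ̄`, so those who want to book are compared with a Poisson variable of mean
`θ ȳ`, while the loads are an independent Poisson variable of mean `θ d ≥ θ ȳ`. An exponential
bound with parameter `1 / √θ` then shows that only `O(√θ)` booking carriers find no load. Hence
`u` satisfies the fluid flow balance up to `O(√θ)`, and a maximum principle for the balance
equation yields `0 ≤ θ ȳ - u ≤ (K / √θ) θ ȳ`. The profit is affine in `u`, and the fluid value is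
linear in `θ`.
-/

open scoped NNReal ENNReal

section ProductMeasures

lemma bind_prod {α β γ : Type*} [MeasurableSpace α] [MeasurableSpace β] [MeasurableSpace γ]
    {μ : Measure α} {κ : α → Measure β} (hκ : Measurable κ) [∀ x, SFinite (κ x)]
    [SFinite (μ.bind κ)] {ν : Measure γ} [SFinite ν]
    (hκν : Measurable fun x => (κ x).prod ν) :
    μ.bind (fun x => (κ x).prod ν) = (μ.bind κ).prod ν := by
  ext s hs
  rw [Measure.bind_apply hs hκν.aemeasurable, Measure.prod_apply hs,
    Measure.lintegral_bind hκ.aemeasurable (measurable_measure_prodMk_left hs).aemeasurable]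
  exact lintegral_congr fun x => Measure.prod_apply hs

variable {ι : Type*} [Fintype ι] {α : ι → Type*} [∀ i, MeasurableSpace (α i)]
  (μ : ∀ i, Measure (α i)) [∀ i, IsProbabilityMeasure (μ i)]

lemma lintegral_pi_eval (i : ι) {f : α i → ℝ≥0∞} (hf : Measurable f) :
    ∫⁻ x, f (x i) ∂(Measure.pi μ) = ∫⁻ x, f x ∂(μ i) :=
  (measurePreserving_eval μ i).lintegral_comp hf

lemma lintegral_pi_prod {f : ∀ i, α i → ℝ≥0∞} (hf : ∀ i, Measurable (f i)) :
    ∫⁻ x, ∏ i, f i (x i) ∂(Measure.pi μ) = ∏ i, ∫⁻ x, f i x ∂(μ i) := by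
  rw [lintegral_prod_eq_prod_lintegral_of_indepFun Finset.univ
    (fun i (x : ∀ i, α i) => f i (x i)) (iIndepFun_pi fun i => (hf i).aemeasurable)
    fun i => (hf i).comp (measurable_pi_apply i)]
  exact Finset.prod_congr rfl fun i _ => lintegral_pi_eval μ i (hf i)

end ProductMeasures

section Poisson

lemma lintegral_poissonMeasure (r : ℝ≥0) (f : ℕ → ℝ≥0∞) :
    ∫⁻ k, f k ∂(poissonMeasure r)
      = ∑' k : ℕ, ENNReal.ofReal (Real.exp (-r) * r ^ k / k.factorial) * f k := by
  simp only [poissonMeasure, lintegral_sum_measure, lintegral_smul_measure, lintegral_dirac,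
    smul_eq_mul]

lemma lintegral_poissonMeasure_pow (r w : ℝ≥0) :
    ∫⁻ k, (w : ℝ≥0∞) ^ k ∂(poissonMeasure r) = ENNReal.ofReal (Real.exp (r * (w - 1))) := by
  have hsum : HasSum (fun k : ℕ => Real.exp (-r) * r ^ k / k.factorial * w ^ k)
      (Real.exp (r * (w - 1))) := by
    have h := (NormedSpace.expSeries_div_hasSum_exp ((r * w : ℝ))).mul_left (Real.exp (-r))
    rw [← Real.exp_eq_exp_ℝ, ← Real.exp_add, neg_add_eq_sub, ← mul_sub_one] at h
    exact h.congr_fun fun k => by rw [mul_pow]; ring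
  rw [lintegral_poissonMeasure, ← hsum.tsum_eq,
    ENNReal.ofReal_tsum_of_nonneg (fun k => by positivity) hsum.summable]
  refine tsum_congr fun k => ?_
  rw [ENNReal.ofReal_mul (by positivity), ENNReal.ofReal_pow w.coe_nonneg,
    ENNReal.ofReal_coe_nnreal]

lemma lintegral_poissonMeasure_natCast (r : ℝ≥0) :
    ∫⁻ k, (k : ℝ≥0∞) ∂(poissonMeasure r) = r := by
  have hshift (k : ℕ) : ENNReal.ofReal (Real.exp (-r) * r ^ (k + 1) / (k + 1).factorial)
      * ((k + 1 : ℕ) : ℝ≥0∞)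
      = r * (ENNReal.ofReal (Real.exp (-r) * r ^ k / k.factorial) * 1) := by
    rw [← ENNReal.ofReal_natCast, ← ENNReal.ofReal_mul (by positivity),
      ← ENNReal.ofReal_coe_nnreal (p := r), mul_one, ← ENNReal.ofReal_mul (by positivity),
      Nat.factorial_succ]
    congr 1
    push_cast
    field_simp
    ring
  rw [lintegral_poissonMeasure, tsum_eq_zero_add' ENNReal.summable]
  simp_rw [hshift]
  rw [ENNReal.tsum_mul_left, ← lintegral_poissonMeasure]
  simp

end Poisson

section FactorialMGF

variable {ι : Type*} [Fintype ι]

/-- The factorial moment generating function `x ↦ E ∏ᵢ (1 + xᵢ) ^ Sᵢ` of a random vector `S` of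
counts with law `μ`. -/
noncomputable def factorialMGF (μ : Measure (ι → ℕ)) (x : ι → ℝ≥0) : ℝ≥0∞ :=
  ∫⁻ S, ∏ i, (1 + x i : ℝ≥0∞) ^ S i ∂μ

lemma factorialMGF_dirac (S : ι → ℕ) (x : ι → ℝ≥0) :
    factorialMGF (Measure.dirac S) x = ∏ i, (1 + x i : ℝ≥0∞) ^ S i :=
  lintegral_dirac _ _

lemma factorialMGF_bind {α : Type*} [MeasurableSpace α] {μ : Measure α} {κ : α → Measure (ι → ℕ)}
    (hκ : Measurable κ) (x : ι → ℝ≥0) :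
    factorialMGF (μ.bind κ) x = ∫⁻ a, factorialMGF (κ a) x ∂μ :=
  Measure.lintegral_bind hκ.aemeasurable Measurable.of_discrete.aemeasurable

lemma factorialMGF_single [DecidableEq ι] (μ : Measure (ι → ℕ)) (i : ι) (x : ℝ≥0) :
    factorialMGF μ (Pi.single i x) = ∫⁻ S, (1 + x : ℝ≥0∞) ^ S i ∂μ := by
  refine lintegral_congr fun S => ?_
  rw [Finset.prod_eq_single i] <;> simp +contextual

lemma factorialMGF_map_add_prod (μ ν : Measure (ι → ℕ)) [SFinite ν] (x : ι → ℝ≥0) :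
    factorialMGF ((μ.prod ν).map fun w => w.1 + w.2) x
      = factorialMGF μ x * factorialMGF ν x := by
  rw [factorialMGF, lintegral_map .of_discrete .of_discrete]
  simp only [Pi.add_apply, pow_add, Finset.prod_mul_distrib]
  have hmeas : Measurable fun S : ι → ℕ => ∏ i, (1 + x i : ℝ≥0∞) ^ S i := .of_discrete
  exact lintegral_prod_mul hmeas.aemeasurable hmeas.aemeasurable

lemma factorialMGF_map_sum_pi {κ : Type*} [Fintype κ] (μ : κ → Measure (ι → ℕ))
    [∀ k, IsProbabilityMeasure (μ k)] (x : ι → ℝ≥0) :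
    factorialMGF ((Measure.pi μ).map fun v => ∑ k, v k) x = ∏ k, factorialMGF (μ k) x := by
  rw [factorialMGF, lintegral_map .of_discrete .of_discrete]
  simp only [Finset.sum_apply, ← Finset.prod_pow_eq_pow_sum]
  simp_rw [Finset.prod_comm (s := Finset.univ (α := ι))]
  exact lintegral_pi_prod μ (f := fun _ S => ∏ i, (1 + x i : ℝ≥0∞) ^ S i) fun _ => .of_discrete

lemma factorialMGF_pi_poissonMeasure (r : ι → ℝ≥0) (x : ι → ℝ≥0) :
    factorialMGF (Measure.pi fun i => poissonMeasure (r i)) x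
      = ENNReal.ofReal (Real.exp (∑ i, r i * x i)) := by
  rw [factorialMGF, lintegral_pi_prod _ (f := fun i k => (1 + x i : ℝ≥0∞) ^ k)
    (fun i => .of_discrete), Real.exp_sum, ENNReal.ofReal_prod_of_nonneg fun _ _ => by positivity]
  refine Finset.prod_congr rfl fun i _ => ?_
  simpa using lintegral_poissonMeasure_pow (r i) (1 + x i)

end FactorialMGF

section Doeblin

variable {α : Type*} [MeasurableSpace α]

lemma integral_mem_Icc (μ : Measure α) [IsProbabilityMeasure μ] {f : α → ℝ} (hf : Measurable f)
    {a b : ℝ} (hab : ∀ x, f x ∈ Set.Icc a b) : ∫ x, f x ∂μ ∈ Set.Icc a b := by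
  have hint : Integrable f μ := .of_mem_Icc a b hf.aemeasurable (ae_of_all _ hab)
  constructor
  · simpa using integral_mono (integrable_const a) hint fun x => (hab x).1
  · simpa using integral_mono hint (integrable_const b) fun x => (hab x).2

lemma integral_mem_Icc_of_le {μ ν : Measure α} [IsProbabilityMeasure μ] (hνμ : ν ≤ μ)
    {f : α → ℝ} (hf : Measurable f) {a b : ℝ} (hab : ∀ x, f x ∈ Set.Icc a b) :
    ∫ x, f x ∂μ ∈ Set.Icc (a + ∫ x, (f x - a) ∂ν) (b - ∫ x, (b - f x) ∂ν) := by
  have hint : Integrable f μ := .of_mem_Icc a b hf.aemeasurable (ae_of_all _ hab)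
  have hlow := integral_mono_measure hνμ (ae_of_all _ fun x => sub_nonneg.2 (hab x).1)
    (hint.sub (integrable_const a))
  have hupp := integral_mono_measure hνμ (ae_of_all _ fun x => sub_nonneg.2 (hab x).2)
    ((integrable_const b).sub hint)
  rw [integral_sub hint (integrable_const a), integral_const, probReal_univ, one_smul] at hlow
  rw [integral_sub (integrable_const b) hint, integral_const, probReal_univ, one_smul] at hupp
  constructor <;> linarith

lemma integral_pow_add {κ : Kernel α α} {f : α → ℝ} (s t : ℕ) (x : α)
    (hf : Integrable f ((κ ^ (s + t)) x)) :
    ∫ y, f y ∂((κ ^ (s + t)) x) = ∫ y, ∫ z, f z ∂((κ ^ s) y) ∂((κ ^ t) x) := by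
  rw [pow_add] at hf ⊢
  exact Kernel.integral_comp hf

variable {κ : Kernel α α} [IsMarkovKernel κ]

instance (t : ℕ) : IsMarkovKernel (κ ^ t) := by
  induction t with
  | zero => exact inferInstanceAs (IsMarkovKernel Kernel.id)
  | succ t ih => rw [pow_succ]; exact inferInstanceAs (IsMarkovKernel ((κ ^ t) ∘ₖ κ))

variable {m : ℕ} {ν : Measure α} [IsFiniteMeasure ν] {f : α → ℝ} {B : ℝ}

lemma exists_Icc_of_minorization (hν : ∀ x, ν ≤ (κ ^ m) x) (hf : Measurable f)
    (hB : ∀ x, |f x| ≤ B) (k : ℕ) :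
    ∃ a b, b - a = (1 - ν.real Set.univ) ^ k * (2 * B) ∧
      ∀ t ≥ m * k, ∀ x, ∫ y, f y ∂((κ ^ t) x) ∈ Set.Icc a b := by
  have hfB (x : α) : f x ∈ Set.Icc (-B) B := abs_le.1 (hB x)
  have hint (t : ℕ) (x : α) : Integrable f ((κ ^ t) x) :=
    .of_mem_Icc (-B) B hf.aemeasurable (ae_of_all _ hfB)
  have hmeas (t : ℕ) : Measurable fun x => ∫ y, f y ∂((κ ^ t) x) :=
    hf.stronglyMeasurable.integral_kernel.measurable
  induction k with
  | zero => exact ⟨-B, B, by ring, fun t _ x => integral_mem_Icc _ hf hfB⟩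
  | succ k ih =>
    obtain ⟨a, b, hab, hk⟩ := ih
    set g : α → ℝ := fun x => ∫ y, f y ∂((κ ^ (m * k)) x)
    have hg (x : α) : g x ∈ Set.Icc a b := hk _ le_rfl x
    refine ⟨a + ∫ x, (g x - a) ∂ν, b - ∫ x, (b - g x) ∂ν, ?_, fun t ht x => ?_⟩
    · have hgi : Integrable g ν := .of_mem_Icc a b (hmeas _).aemeasurable (ae_of_all _ hg)
      rw [integral_sub hgi (integrable_const a), integral_sub (integrable_const b) hgi,
        integral_const, integral_const, smul_eq_mul, smul_eq_mul, pow_succ, mul_right_comm, ← hab]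
      ring
    · obtain ⟨s, rfl⟩ := Nat.exists_eq_add_of_le ht
      have hstep (x : α) : ∫ y, f y ∂((κ ^ (m * (k + 1))) x) ∈
          Set.Icc (a + ∫ x, (g x - a) ∂ν) (b - ∫ x, (b - g x) ∂ν) := by
        rw [mul_add_one, integral_pow_add _ _ _ (hint _ x)]
        exact integral_mem_Icc_of_le (hν x) (hmeas _) hg
      rw [integral_pow_add _ _ _ (hint _ x)]
      exact integral_mem_Icc _ (hmeas _) hstep

theorem exists_tendsto_integral_of_minorization [NeZero ν] (hν : ∀ x, ν ≤ (κ ^ m) x)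
    (hf : Measurable f) (hB : ∀ x, |f x| ≤ B) :
    ∃ l : ℝ, ∀ x, Tendsto (fun t => ∫ y, f y ∂((κ ^ t) x)) atTop (𝓝 l) := by
  obtain ⟨x₀⟩ := Measure.nonempty_of_neZero ν
  have hε : 0 < ν.real Set.univ := by simp [measureReal_def, ENNReal.toReal_pos_iff, NeZero.ne]
  have hε1 : ν.real Set.univ ≤ 1 := by
    simpa [measureReal_def] using ENNReal.toReal_mono (by simp) (hν x₀ Set.univ)
  have hclose {δ : ℝ} (hδ : 0 < δ) :
      ∃ N, ∀ s ≥ N, ∀ t ≥ N, ∀ x y, dist (∫ z, f z ∂((κ ^ s) x)) (∫ z, f z ∂((κ ^ t) y)) < δ := by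
    have hlim : Tendsto (fun k => (1 - ν.real Set.univ) ^ k * (2 * B)) atTop (𝓝 0) := by
      simpa using (tendsto_pow_atTop_nhds_zero_of_lt_one (sub_nonneg.2 hε1)
        (sub_lt_self 1 hε)).mul_const (2 * B)
    obtain ⟨k, hk⟩ := (hlim.eventually_lt_const hδ).exists
    obtain ⟨a, b, hab, hmem⟩ := exists_Icc_of_minorization hν hf hB k
    exact ⟨m * k, fun s hs t ht x y =>
      (Real.dist_le_of_mem_Icc (hmem s hs x) (hmem t ht y)).trans_lt (hab ▸ hk)⟩
  obtain ⟨l, hl⟩ := cauchySeq_tendsto_of_complete (u := fun t => ∫ z, f z ∂((κ ^ t) x₀))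
    (Metric.cauchySeq_iff.2 fun δ hδ => (hclose hδ).imp fun N h s hs t ht => h s hs t ht x₀ x₀)
  refine ⟨l, fun x => hl.congr_dist (tendsto_order.2 ⟨fun δ hδ => ?_, fun δ hδ => ?_⟩)⟩
  · exact Eventually.of_forall fun t => hδ.trans_le dist_nonneg
  · obtain ⟨N, hN⟩ := hclose hδ
    filter_upwards [eventually_ge_atTop N] with t ht using hN t ht t ht x₀ x

end Doeblin

section MaximumPrinciple

lemma le_smul_of_le_map_add {ι : Type*} [Finite ι] {A : (ι → ℝ) →ₗ[ℝ] ι → ℝ} (hA : Monotone A)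
    {y δ ε : ι → ℝ} {η κ : ℝ} (hη : 0 < η) (hκ : 0 ≤ κ) (hy : 0 ≤ y) (hAy : A y ≤ (1 - η) • y)
    (hδ : δ ≤ A δ + ε) (hε : ∀ i, 0 < y i → ε i ≤ η * (κ * y i))
    (hδ0 : ∀ i, y i = 0 → δ i ≤ 0) : δ ≤ κ • y := by
  by_contra h
  obtain ⟨j, hj⟩ : ∃ j, κ * y j < δ j := by simpa [Pi.le_def] using h
  have hyj : 0 < y j := (hy j).lt_of_ne' fun (h0 : y j = 0) => by
    rw [h0, mul_zero] at hj
    exact hj.not_ge (hδ0 j h0)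
  have : Nonempty {i // 0 < y i} := ⟨⟨j, hyj⟩⟩
  obtain ⟨⟨i, hyi⟩, hmax⟩ := Finite.exists_max fun i : {i // 0 < y i} => δ i / y i
  set ρ := δ i / y i
  have hρ : κ < ρ := ((lt_div_iff₀ hyj).2 hj).trans_le (hmax ⟨j, hyj⟩)
  have hδρ : δ ≤ ρ • y := fun k => by
    rcases (hy k).eq_or_lt' with h0 | hk
    · simpa [h0] using hδ0 k h0
    · exact (div_le_iff₀ hk).1 (hmax ⟨k, hk⟩)
  have hδi : δ i = ρ * y i := (div_mul_cancel₀ _ hyi.ne').symm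
  have hAδ : A δ i ≤ ρ * ((1 - η) * y i) := by
    refine (hA hδρ i).trans ?_
    rw [map_smul]
    exact mul_le_mul_of_nonneg_left (hAy i) (hκ.trans hρ.le)
  have hle : δ i ≤ A δ i + ε i := hδ i
  nlinarith [hε i hyi, mul_pos (mul_pos hη hyi) (sub_pos.2 hρ)]

end MaximumPrinciple

section Excess

lemma natCast_le_min_add_exp {s : ℝ} (hs : 0 < s) (k l : ℕ) :
    (k : ℝ≥0∞) ≤ (min k l : ℕ) + ENNReal.ofReal s⁻¹
      * (ENNReal.ofReal (Real.exp s) ^ k * ENNReal.ofReal (Real.exp (-s)) ^ l) := by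
  have hreal : (k : ℝ) ≤ (min k l : ℕ) + s⁻¹ * (Real.exp s ^ k * Real.exp (-s) ^ l) := by
    rw [← Real.exp_nat_mul, ← Real.exp_nat_mul, ← Real.exp_add]
    rcases le_total k l with h | h
    · rw [min_eq_left h, le_add_iff_nonneg_right]
      positivity
    · rw [min_eq_right h, ← sub_le_iff_le_add', inv_mul_eq_div, le_div_iff₀ hs]
      nlinarith [Real.add_one_le_exp (k * s + l * -s)]
  rw [← ENNReal.ofReal_pow (by positivity), ← ENNReal.ofReal_pow (by positivity),
    ← ENNReal.ofReal_mul (by positivity), ← ENNReal.ofReal_mul (by positivity),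
    ← ENNReal.ofReal_natCast, ← ENNReal.ofReal_natCast, ← ENNReal.ofReal_add (by positivity)
    (by positivity)]
  exact ENNReal.ofReal_le_ofReal hreal

lemma exp_sub_one_add_exp_neg_sub_one_le {s : ℝ} (hs : |s| ≤ 1) :
    (Real.exp s - 1) + (Real.exp (-s) - 1) ≤ 2 * s ^ 2 := by
  have hpos := (abs_le.1 (Real.abs_exp_sub_one_sub_id_le hs)).2
  have hneg := (abs_le.1 (Real.abs_exp_sub_one_sub_id_le (x := -s) (by rwa [abs_neg]))).2
  rw [neg_sq] at hneg
  linarith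

lemma ofReal_exp_eq_one_add {s : ℝ} (hs : 0 ≤ s) :
    ENNReal.ofReal (Real.exp s) = 1 + ((Real.exp s - 1).toNNReal : ℝ≥0∞) := by
  change _ = 1 + ENNReal.ofReal _
  rw [← ENNReal.ofReal_one, ← ENNReal.ofReal_add zero_le_one (sub_nonneg.2 (Real.one_le_exp hs)),
    add_sub_cancel]

end Excess

section Asymptotics

lemma exists_pos_mul_le {ι : Type*} [Finite ι] (a : ι → ℝ) {b : ι → ℝ} (hb : ∀ i, 0 < b i) :
    ∃ η : ℝ, 0 < η ∧ ∀ i, η * a i ≤ b i := by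
  have hev (i : ι) : ∀ᶠ η : ℝ in 𝓝[>] 0, η * a i ≤ b i := by
    have hlim : Tendsto (fun η : ℝ => η * a i) (𝓝[>] 0) (𝓝 (0 * a i)) :=
      (tendsto_id.mul_const (a i)).mono_left nhdsWithin_le_nhds
    exact hlim.eventually_le_const (by simpa using hb i)
  obtain ⟨η, hη, hη0⟩ := ((eventually_all.2 hev).and self_mem_nhdsWithin).exists
  exact ⟨η, hη0, hη⟩

lemma exists_nonneg_le_mul {ι : Type*} [Finite ι] (a b : ι → ℝ) :
    ∃ K : ℝ, 0 ≤ K ∧ ∀ i, 0 < b i → a i ≤ K * b i := by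
  have hev (i : ι) : ∀ᶠ K : ℝ in atTop, 0 < b i → a i ≤ K * b i := by
    by_cases hb : 0 < b i
    · exact ((tendsto_id.atTop_mul_const hb).eventually_ge_atTop (a i)).mono fun _ h _ => h
    · exact Eventually.of_forall fun _ h => absurd h hb
  obtain ⟨K, hK, hK0⟩ := ((eventually_all.2 hev).and (eventually_ge_atTop 0)).exists
  exact ⟨K, hK0, hK⟩

lemma inv_inv_sqrt_mul_exp_le {θ d y η K : ℝ} (hθ : 0 < θ) (hK : Real.exp (2 * d) ≤ K * (η * y)) :
    (√θ)⁻¹⁻¹ * Real.exp (θ * d * (2 * (√θ)⁻¹ ^ 2)) ≤ η * (K / √θ * (θ * y)) := by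
  calc (√θ)⁻¹⁻¹ * Real.exp (θ * d * (2 * (√θ)⁻¹ ^ 2))
      = √θ * Real.exp (2 * d) := by
        rw [inv_inv, inv_pow, Real.sq_sqrt hθ.le]
        field_simp
    _ ≤ √θ * (K * (η * y)) := by gcongr
    _ = η * (K / √θ * (√θ ^ 2 * y)) := by field_simp
    _ = η * (K / √θ * (θ * y)) := by rw [Real.sq_sqrt hθ.le]

lemma isBigO_one_sub_div_of_abs_sub_le {f g : ℝ → ℝ} {V C : ℝ} (hV : 0 < V)
    (hg : ∀ θ, 1 ≤ θ → g θ = θ * V) (hfg : ∀ θ, 1 ≤ θ → |g θ - f θ| ≤ C * √θ) :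
    (fun θ => 1 - f θ / g θ) =O[atTop] fun θ => 1 / √θ := by
  refine IsBigO.of_bound (C / V) ?_
  filter_upwards [eventually_ge_atTop 1] with θ hθ
  have hpos : 0 < g θ := by
    rw [hg θ hθ]
    positivity
  rw [Real.norm_eq_abs, Real.norm_of_nonneg (by positivity), one_sub_div hpos.ne', abs_div,
    abs_of_pos hpos, div_le_iff₀ hpos]
  refine (hfg θ hθ).trans_eq ?_
  rw [hg θ hθ]
  field_simp
  rw [Real.sq_sqrt (by positivity)]

lemma tendsto_of_isBigO_one_sub {f : ℝ → ℝ} (hf : (fun θ => 1 - f θ) =O[atTop] fun θ => 1 / √θ) :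
    Tendsto f atTop (𝓝 1) := by
  have hsqrt : Tendsto (fun θ => 1 / √θ) atTop (𝓝 0) :=
    tendsto_const_nhds.div_atTop Real.tendsto_sqrt_atTop
  simpa using (hf.trans_tendsto hsqrt).const_sub 1

end Asymptotics

namespace FreightMarket

variable {n : ℕ} {E : Finset (Fin n × Fin n)} (M : FreightMarket E)

/-- The probabilistic primitives are genuine probabilities, so that the laws governing the Markov
chain are probability measures. -/
class IsStochastic : Prop where
  stay_nonneg : ∀ e, 0 ≤ M.stay e
  stay_sum_le_one : ∀ j : Fin n, ∑ e : E with e.1.1 = j, M.stay e ≤ 1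
  cost_prob : ∀ e, IsProbabilityMeasure (M.costLaw e)

attribute [instance] IsStochastic.cost_prob

instance [hM : M.IsStochastic] (θ : ℝ) : (M.scale θ).IsStochastic :=
  ⟨hM.stay_nonneg, hM.stay_sum_le_one, hM.cost_prob⟩

section Booking

/-- The probability that a carrier accepts the posted price. -/
noncomputable def acceptProb (p : E → ℝ) (e : E) : ℝ≥0 := (M.costLaw e (Set.Iic (p e))).toNNReal

lemma measurable_bookings (p : E → ℝ) (S : E → ℕ) :
    Measurable fun (c : (Σ e : E, Fin (S e)) → ℝ) (e : E) =>
      Fintype.card {s : Fin (S e) // c ⟨e, s⟩ ≤ p e} := by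
  refine measurable_pi_lambda _ fun e => ?_
  simp_rw [Fintype.card_subtype, Finset.card_filter]
  exact Finset.measurable_sum _ fun s _ => .ite
    (measurableSet_le (measurable_pi_apply _) measurable_const) measurable_const measurable_const

variable [M.IsStochastic] (p : E → ℝ) (S : E → ℕ)

lemma coe_acceptProb (e : E) : (M.acceptProb p e : ℝ≥0∞) = M.costLaw e (Set.Iic (p e)) :=
  ENNReal.coe_toNNReal (measure_ne_top _ _)

instance : IsProbabilityMeasure (M.bookingLaw p S) :=
  Measure.isProbabilityMeasure_map (measurable_bookings p S).aemeasurable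

lemma factorialMGF_bookingLaw (x : E → ℝ≥0) :
    factorialMGF (M.bookingLaw p S) x
      = ∏ e, (1 + (M.acceptProb p e * x e : ℝ≥0) : ℝ≥0∞) ^ S e := by
  have hprod (c : (Σ e : E, Fin (S e)) → ℝ) :
      ∏ e, (1 + x e : ℝ≥0∞) ^ Fintype.card {s : Fin (S e) // c ⟨e, s⟩ ≤ p e}
        = ∏ s : (Σ e : E, Fin (S e)),
          (1 + (Set.Iic (p s.1)).indicator (fun _ => (x s.1 : ℝ≥0∞)) (c s)) := by
    rw [Fintype.prod_sigma]
    refine Finset.prod_congr rfl fun e _ => ?_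
    rw [Fintype.card_subtype, ← Finset.prod_const, Finset.prod_filter]
    refine Finset.prod_congr rfl fun s _ => ?_
    by_cases h : c ⟨e, s⟩ ≤ p e <;> simp [h]
  rw [factorialMGF, bookingLaw, lintegral_map .of_discrete (measurable_bookings p S)]
  simp_rw [hprod]
  rw [lintegral_pi_prod (fun s : (Σ e : E, Fin (S e)) => M.costLaw s.1)
    (f := fun s c => 1 + (Set.Iic (p s.1)).indicator (fun _ => (x s.1 : ℝ≥0∞)) c)
    (fun s => measurable_const.add (measurable_const.indicator measurableSet_Iic)),
    Fintype.prod_sigma]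
  refine Finset.prod_congr rfl fun e _ => ?_
  simp_rw [lintegral_add_left (measurable_const (a := (1 : ℝ≥0∞))),
    lintegral_indicator_const measurableSet_Iic, ← coe_acceptProb]
  simp [mul_comm]

lemma lintegral_eval_bookingLaw (e : E) :
    ∫⁻ X, (X e : ℝ≥0∞) ∂(M.bookingLaw p S) = M.acceptProb p e * S e := by
  have hsum (c : (Σ e : E, Fin (S e)) → ℝ) :
      ((Fintype.card {s : Fin (S e) // c ⟨e, s⟩ ≤ p e} : ℕ) : ℝ≥0∞)
        = ∑ s : Fin (S e), (Set.Iic (p e)).indicator (fun _ => (1 : ℝ≥0∞)) (c ⟨e, s⟩) := by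
    rw [Fintype.card_subtype, Finset.card_filter]
    push_cast
    exact Finset.sum_congr rfl fun s _ => by by_cases h : c ⟨e, s⟩ ≤ p e <;> simp [h]
  have hmeas : Measurable ((Set.Iic (p e)).indicator fun _ => (1 : ℝ≥0∞)) :=
    measurable_const.indicator measurableSet_Iic
  rw [bookingLaw, lintegral_map .of_discrete (measurable_bookings p S)]
  simp_rw [hsum]
  rw [lintegral_finsetSum Finset.univ
    (f := fun (s : Fin (S e)) (c : (Σ e : E, Fin (S e)) → ℝ) =>
      (Set.Iic (p e)).indicator (fun _ => (1 : ℝ≥0∞)) (c ⟨e, s⟩))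
    fun s _ => hmeas.comp (measurable_pi_apply _)]
  simp_rw [lintegral_pi_eval (fun s : (Σ e : E, Fin (S e)) => M.costLaw s.1) ⟨e, _⟩ hmeas]
  rw [lintegral_indicator_const measurableSet_Iic, ← coe_acceptProb]
  simp [mul_comm]

end Booking

section Routing

lemma lintegral_routeLaw (j : Fin n) (f : (E → ℕ) → ℝ≥0∞) :
    ∫⁻ v, f v ∂(M.routeLaw j) = ∑ e : E with e.1.1 = j, (M.stay e).toNNReal * f (Pi.single e 1)
      + ENNReal.ofReal (1 - ∑ e : E with e.1.1 = j, M.stay e) * f 0 := by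
  rw [routeLaw, lintegral_add_measure, lintegral_finsetSum_measure]
  simp only [lintegral_smul_measure, lintegral_dirac, smul_eq_mul]
  rfl

lemma lintegral_eval_routeLaw (j : Fin n) (e : E) :
    ∫⁻ v, (v e : ℝ≥0∞) ∂(M.routeLaw j) = if e.1.1 = j then ((M.stay e).toNNReal : ℝ≥0∞) else 0 := by
  rw [lintegral_routeLaw]
  simp [Pi.single_apply, Finset.sum_ite_eq]

variable [hM : M.IsStochastic]

lemma sum_stay_add_leave (j : Fin n) :
    ∑ e : E with e.1.1 = j, ((M.stay e).toNNReal : ℝ≥0∞)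
      + ENNReal.ofReal (1 - ∑ e : E with e.1.1 = j, M.stay e) = 1 := by
  have hofReal : ∑ e : E with e.1.1 = j, ((M.stay e).toNNReal : ℝ≥0∞)
      = ENNReal.ofReal (∑ e : E with e.1.1 = j, M.stay e) :=
    (ENNReal.ofReal_sum_of_nonneg fun e _ => hM.stay_nonneg e).symm
  rw [hofReal, ← ENNReal.ofReal_add (Finset.sum_nonneg fun e _ => hM.stay_nonneg e)
    (sub_nonneg.2 (hM.stay_sum_le_one j)), add_sub_cancel, ENNReal.ofReal_one]

instance (j : Fin n) : IsProbabilityMeasure (M.routeLaw j) where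
  measure_univ := by
    rw [← lintegral_one, lintegral_routeLaw]
    simpa using M.sum_stay_add_leave j

instance (Y : E → ℕ) : IsProbabilityMeasure (M.returnLaw Y) :=
  Measure.isProbabilityMeasure_map Measurable.of_discrete.aemeasurable

lemma factorialMGF_routeLaw (j : Fin n) (x : E → ℝ≥0) :
    factorialMGF (M.routeLaw j) x
      = 1 + (∑ e : E with e.1.1 = j, (M.stay e).toNNReal * x e : ℝ≥0) := by
  have hsingle (e : E) : ∏ i, (1 + x i : ℝ≥0∞) ^ (Pi.single e 1 : E → ℕ) i = 1 + x e := by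
    rw [Finset.prod_eq_single e] <;> simp +contextual
  rw [factorialMGF, lintegral_routeLaw]
  simp_rw [hsingle, mul_add, mul_one, Finset.sum_add_distrib, Pi.zero_apply, pow_zero,
    Finset.prod_const_one, mul_one]
  rw [add_right_comm, M.sum_stay_add_leave j]
  push_cast
  rfl

lemma factorialMGF_returnLaw (Y : E → ℕ) (x : E → ℝ≥0) :
    factorialMGF (M.returnLaw Y) x
      = ∏ k : E, (1 + (∑ e : E with e.1.1 = k.1.2, (M.stay e).toNNReal * x e : ℝ≥0) : ℝ≥0∞)
          ^ Y k := by
  rw [returnLaw, factorialMGF_map_sum_pi, Fintype.prod_sigma]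
  simp [factorialMGF_routeLaw]

lemma lintegral_eval_returnLaw (Y : E → ℕ) (e : E) :
    ∫⁻ Z, (Z e : ℝ≥0∞) ∂(M.returnLaw Y)
      = ∑ k : E with k.1.2 = e.1.1, (M.stay e).toNNReal * (Y k : ℝ≥0∞) := by
  rw [returnLaw, lintegral_map .of_discrete .of_discrete]
  simp_rw [Finset.sum_apply, Nat.cast_sum]
  rw [lintegral_finsetSum _ fun s _ => .of_discrete]
  simp_rw [lintegral_pi_eval (fun s : (Σ e : E, Fin (Y e)) => M.routeLaw s.1.1.2) _
    (f := fun v => (v e : ℝ≥0∞)) .of_discrete, lintegral_eval_routeLaw]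
  rw [Fintype.sum_sigma, Finset.sum_filter]
  refine Finset.sum_congr rfl fun k _ => ?_
  simp [eq_comm (a := e.1.1), mul_comm]

end Routing

section Exogenous

instance : IsProbabilityMeasure M.arrivalLaw := by
  unfold arrivalLaw; infer_instance

instance (r : E → ℝ) : IsProbabilityMeasure (M.demandLaw r) := by
  unfold demandLaw; infer_instance

lemma lintegral_eval_arrivalLaw (e : E) :
    ∫⁻ A, (A e : ℝ≥0∞) ∂M.arrivalLaw = (M.arrival e).toNNReal := by
  rw [arrivalLaw, lintegral_pi_eval (α := fun _ : E => ℕ) _ e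
    (f := fun k => (k : ℝ≥0∞)) .of_discrete, lintegral_poissonMeasure_natCast]

lemma lintegral_eval_demandLaw (r : E → ℝ) (e : E) :
    ∫⁻ D, (D e : ℝ≥0∞) ∂(M.demandLaw r) = (M.demand e (r e)).toNNReal := by
  rw [demandLaw, lintegral_pi_eval (α := fun _ : E => ℕ) _ e
    (f := fun k => (k : ℝ≥0∞)) .of_discrete, lintegral_poissonMeasure_natCast]

lemma lintegral_pow_eval_demandLaw (r : E → ℝ) (e : E) (w : ℝ≥0) :
    ∫⁻ D, (w : ℝ≥0∞) ^ D e ∂(M.demandLaw r)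
      = ENNReal.ofReal (Real.exp ((M.demand e (r e)).toNNReal * (w - 1))) := by
  rw [demandLaw, lintegral_pi_eval (α := fun _ : E => ℕ) _ e
    (f := fun k => (w : ℝ≥0∞) ^ k) .of_discrete, lintegral_poissonMeasure_pow]

lemma integrable_eval_demandLaw (r : E → ℝ) (e : E) :
    Integrable (fun D => (D e : ℝ)) (M.demandLaw r) := by
  refine ⟨Measurable.of_discrete.aestronglyMeasurable, ?_⟩
  rw [hasFiniteIntegral_iff_ofReal (ae_of_all _ fun D => by positivity)]
  simp [lintegral_eval_demandLaw]

lemma integral_eval_demandLaw (r : E → ℝ) (e : E) :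
    ∫ D, (D e : ℝ) ∂(M.demandLaw r) = (M.demand e (r e)).toNNReal := by
  rw [integral_eq_lintegral_of_nonneg_ae (ae_of_all _ fun D => by positivity)
    Measurable.of_discrete.aestronglyMeasurable]
  simp [lintegral_eval_demandLaw]

lemma demandLaw_singleton_zero_ne_zero (r : E → ℝ) : M.demandLaw r {0} ≠ 0 := by
  rw [demandLaw, Measure.pi_singleton, Finset.prod_ne_zero_iff]
  intro e _
  rw [Pi.zero_apply, poissonMeasure_singleton]
  simp [Real.exp_pos]

end Exogenous

section Transition

/-- Law of the carriers available in the next period, given the state `σ` of this period. -/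
noncomputable def carrierLaw (p : E → ℝ) (σ : FreightState E) : Measure (E → ℕ) :=
  (M.bookingLaw p σ.1).bind fun X =>
    ((M.returnLaw (shipped X σ.2)).prod M.arrivalLaw).map fun w => w.1 + w.2

/-- Expected number of loads transported on lane `e` in state `σ`. -/
noncomputable def meanShipped (p : E → ℝ) (e : E) (σ : FreightState E) : ℝ≥0∞ :=
  ∫⁻ X, (shipped X σ.2 e : ℝ≥0∞) ∂(M.bookingLaw p σ.1)

variable (r p : E → ℝ) (σ : FreightState E)

lemma stepLaw_eq_prod : M.stepLaw r p σ = (M.carrierLaw p σ).prod (M.demandLaw r) :=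
  bind_prod .of_discrete .of_discrete

variable [M.IsStochastic]

instance : IsProbabilityMeasure (M.carrierLaw p σ) := by
  have (X : E → ℕ) : IsProbabilityMeasure
      (((M.returnLaw (shipped X σ.2)).prod M.arrivalLaw).map fun w => w.1 + w.2) :=
    Measure.isProbabilityMeasure_map Measurable.of_discrete.aemeasurable
  refine ⟨?_⟩
  rw [carrierLaw, Measure.bind_apply .univ Measurable.of_discrete.aemeasurable]
  simp

instance : IsProbabilityMeasure (M.stepLaw r p σ) := by
  rw [stepLaw_eq_prod]; infer_instance

lemma stepLaw_no_loads (S : E → ℕ) : M.stepLaw r p (S, 0) = M.stepLaw r p 0 := by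
  have hshipped (X : E → ℕ) : shipped X (0 : E → ℕ) = 0 := by ext e; simp [shipped]
  simp [stepLaw, hshipped, Measure.bind_const]

lemma meanShipped_le_loads (e : E) : M.meanShipped p e σ ≤ σ.2 e := by
  calc M.meanShipped p e σ ≤ ∫⁻ _, (σ.2 e : ℝ≥0∞) ∂(M.bookingLaw p σ.1) :=
        lintegral_mono fun X => Nat.cast_le.2 (min_le_right (X e) (σ.2 e))
    _ = σ.2 e := by simp

lemma meanShipped_le_accept (e : E) : M.meanShipped p e σ ≤ M.acceptProb p e * σ.1 e := by
  rw [← lintegral_eval_bookingLaw]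
  exact lintegral_mono fun X => Nat.cast_le.2 (min_le_left (X e) (σ.2 e))

lemma lintegral_eval_carrierLaw (e : E) :
    ∫⁻ S, (S e : ℝ≥0∞) ∂(M.carrierLaw p σ)
      = ∑ k : E with k.1.2 = e.1.1, (M.stay e).toNNReal * M.meanShipped p k σ
        + (M.arrival e).toNNReal := by
  have hreturn (Y : E → ℕ) :
      ∫⁻ S, (S e : ℝ≥0∞) ∂(((M.returnLaw Y).prod M.arrivalLaw).map fun w => w.1 + w.2)
        = ∑ k : E with k.1.2 = e.1.1, (M.stay e).toNNReal * (Y k : ℝ≥0∞)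
          + (M.arrival e).toNNReal := by
    rw [lintegral_map .of_discrete .of_discrete, ← lintegral_eval_returnLaw,
      ← lintegral_eval_arrivalLaw, lintegral_prod _ Measurable.of_discrete.aemeasurable]
    simp only [Pi.add_apply, Nat.cast_add]
    simp [lintegral_add_left (Measurable.of_discrete (α := E → ℕ))]
  rw [carrierLaw, Measure.lintegral_bind Measurable.of_discrete.aemeasurable
    Measurable.of_discrete.aemeasurable]
  simp_rw [hreturn]
  rw [lintegral_add_right _ measurable_const, lintegral_finsetSum _ fun _ _ => .of_discrete]
  simp_rw [lintegral_const_mul _ Measurable.of_discrete]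
  simp [meanShipped]

lemma factorialMGF_carrierLaw_le (x : E → ℝ≥0) :
    factorialMGF (M.carrierLaw p σ) x
      ≤ (∏ k : E, (1 + (M.acceptProb p k * ∑ e : E with e.1.1 = k.1.2, (M.stay e).toNNReal * x e
          : ℝ≥0) : ℝ≥0∞) ^ σ.1 k)
        * ENNReal.ofReal (Real.exp (∑ e, (M.arrival e).toNNReal * x e)) := by
  rw [carrierLaw, factorialMGF_bind .of_discrete, ← M.factorialMGF_bookingLaw p σ.1
    fun k => ∑ e : E with e.1.1 = k.1.2, (M.stay e).toNNReal * x e, factorialMGF,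
    ← lintegral_mul_const _ Measurable.of_discrete]
  refine lintegral_mono fun X => ?_
  rw [factorialMGF_map_add_prod, factorialMGF_returnLaw, arrivalLaw,
    factorialMGF_pi_poissonMeasure]
  gcongr
  · exact le_self_add
  · exact min_le_left _ _

end Transition

section Chain

variable (r p : E → ℝ)

/-- The transition kernel of the Markov chain. -/
noncomputable def stepKernel : Kernel (FreightState E) (FreightState E) :=
  ⟨M.stepLaw r p, .of_discrete⟩

lemma stepKernel_pow_apply (t : ℕ) (σ : FreightState E) :
    (M.stepKernel r p ^ t) σ = M.stateLaw r p σ t := by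
  induction t with
  | zero => exact Kernel.id_apply σ
  | succ t ih =>
    rw [pow_succ', stateLaw, ← ih]
    exact Kernel.comp_apply _ _ _

lemma stateLaw_succ (σ : FreightState E) (t : ℕ) :
    M.stateLaw r p σ (t + 1)
      = ((M.stateLaw r p σ t).bind (M.carrierLaw p)).prod (M.demandLaw r) := by
  rw [stateLaw, ← bind_prod .of_discrete .of_discrete]
  simp_rw [← stepLaw_eq_prod]

lemma map_fst_stateLaw_succ (σ : FreightState E) (t : ℕ) :
    (M.stateLaw r p σ (t + 1)).map Prod.fst = (M.stateLaw r p σ t).bind (M.carrierLaw p) := by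
  rw [stateLaw_succ, Measure.map_fst_prod, measure_univ, one_smul]

variable [M.IsStochastic]

instance : IsMarkovKernel (M.stepKernel r p) :=
  ⟨fun σ => inferInstanceAs (IsProbabilityMeasure (M.stepLaw r p σ))⟩

instance (σ : FreightState E) (t : ℕ) : IsProbabilityMeasure (M.stateLaw r p σ t) := by
  rw [← stepKernel_pow_apply]
  infer_instance

lemma map_snd_stateLaw_succ (σ : FreightState E) (t : ℕ) :
    (M.stateLaw r p σ (t + 1)).map Prod.snd = M.demandLaw r := by
  have : IsProbabilityMeasure ((M.stateLaw r p σ t).bind (M.carrierLaw p)) := by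
    rw [← map_fst_stateLaw_succ M r p]
    exact Measure.isProbabilityMeasure_map measurable_fst.aemeasurable
  rw [stateLaw_succ, Measure.map_snd_prod, measure_univ, one_smul]

lemma integrable_loads_stateLaw (σ : FreightState E) (t : ℕ) {h : (E → ℕ) → ℝ}
    (hh : Integrable h (M.demandLaw r)) :
    Integrable (fun τ => h τ.2) (M.stateLaw r p σ t) := by
  cases t with
  | zero => exact integrable_dirac (by simp)
  | succ t =>
    rw [← M.map_snd_stateLaw_succ r p σ t] at hh
    exact hh.comp_measurable measurable_snd

lemma integral_loads_stateLaw_succ (σ : FreightState E) (t : ℕ) (h : (E → ℕ) → ℝ) :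
    ∫ τ, h τ.2 ∂(M.stateLaw r p σ (t + 1)) = ∫ D, h D ∂(M.demandLaw r) := by
  rw [← M.map_snd_stateLaw_succ r p σ t, integral_map measurable_snd.aemeasurable
    Measurable.of_discrete.aestronglyMeasurable]

/- Whatever the carriers do, with positive probability there are no loads, and then the next state
is drawn from `stepLaw r p 0`. -/
lemma smul_stepLaw_le_stepKernel_sq (σ : FreightState E) :
    M.demandLaw r {0} • M.stepLaw r p 0 ≤ (M.stepKernel r p ^ 2) σ := by
  have hloads : M.stepLaw r p σ {τ | τ.2 = 0} = M.demandLaw r {0} := by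
    have hset : {τ : FreightState E | τ.2 = 0} = Set.univ ×ˢ {0} := by ext; simp
    rw [hset, stepLaw_eq_prod, Measure.prod_prod, measure_univ, one_mul]
  refine Measure.le_iff.2 fun s hs => ?_
  calc (M.demandLaw r {0} • M.stepLaw r p 0) s
      = ∫⁻ _ in {τ | τ.2 = 0}, M.stepLaw r p 0 s ∂(M.stepLaw r p σ) := by
        rw [setLIntegral_const, hloads, Measure.smul_apply, smul_eq_mul, mul_comm]
    _ = ∫⁻ τ in {τ | τ.2 = 0}, M.stepLaw r p τ s ∂(M.stepLaw r p σ) := by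
        refine setLIntegral_congr_fun .of_discrete ?_
        rintro ⟨S, D⟩ rfl
        exact congrArg (· s) (M.stepLaw_no_loads r p S).symm
    _ ≤ ∫⁻ τ, M.stepLaw r p τ s ∂(M.stepLaw r p σ) := setLIntegral_le_lintegral _ _
    _ = (M.stepKernel r p ^ 2) σ s := by
        rw [pow_two]
        exact (Kernel.comp_apply' (M.stepKernel r p) (M.stepKernel r p) σ hs).symm

lemma exists_tendsto_integral_stateLaw {f : FreightState E → ℝ} {h : (E → ℕ) → ℝ}
    (hh : Integrable h (M.demandLaw r)) (hf : ∀ σ, |f σ| ≤ h σ.2) :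
    ∃ l, ∀ σ, Tendsto (fun t => ∫ τ, f τ ∂(M.stateLaw r p σ t)) atTop (𝓝 l) := by
  have hint (σ : FreightState E) (t : ℕ) : Integrable f (M.stateLaw r p σ t) :=
    (M.integrable_loads_stateLaw r p σ t hh).mono' Measurable.of_discrete.aestronglyMeasurable
      (ae_of_all _ hf)
  have hstate (σ : FreightState E) : M.stepLaw r p σ = M.stateLaw r p σ 1 := by
    simp [← stepKernel_pow_apply, stepKernel]
  have hbound (σ : FreightState E) :
      |∫ τ, f τ ∂(M.stepLaw r p σ)| ≤ ∫ D, h D ∂(M.demandLaw r) := by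
    rw [hstate, ← M.integral_loads_stateLaw_succ r p σ 0]
    exact abs_integral_le_integral_abs.trans (integral_mono (hint σ 1).abs
      (M.integrable_loads_stateLaw r p σ 1 hh) hf)
  have : NeZero (M.demandLaw r {0} • M.stepLaw r p 0) :=
    ⟨fun h0 => (M.demandLaw_singleton_zero_ne_zero r) <| by
      simpa using congrArg (· Set.univ) h0⟩
  have : IsFiniteMeasure (M.demandLaw r {0} • M.stepLaw r p 0) :=
    Measure.smul_finite _ (measure_ne_top _ _)
  obtain ⟨l, hl⟩ := exists_tendsto_integral_of_minorization (M.smul_stepLaw_le_stepKernel_sq r p)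
    .of_discrete hbound
  refine ⟨l, fun σ => (tendsto_add_atTop_iff_nat 1).1 ((hl σ).congr fun t => ?_)⟩
  have hadd : Integrable f ((M.stepKernel r p ^ (1 + t)) σ) := by
    rw [stepKernel_pow_apply]
    exact hint σ _
  rw [← stepKernel_pow_apply, add_comm t, integral_pow_add _ _ _ hadd, stepKernel_pow_apply]
  simp_rw [stepKernel_pow_apply, hstate]

end Chain

section Throughput

variable (r p : E → ℝ)

/-- The profit of a period in which `D` loads arrive and `v` of them are transported, where the
shippers pay for the expected number of loads. -/
def profit (D v : E → ℝ) : ℝ :=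
  ∑ e, (r e * M.demand e (r e) - M.penalty e * (D e - v e) - p e * v e)

/-- The expected numbers of loads transported in period `t`. -/
noncomputable def expectedShipped (σ : FreightState E) (t : ℕ) (e : E) : ℝ :=
  ∫ τ, (M.meanShipped p e τ).toReal ∂(M.stateLaw r p σ t)

lemma expectedShipped_nonneg (σ : FreightState E) (t : ℕ) : 0 ≤ M.expectedShipped r p σ t :=
  fun _ => integral_nonneg fun _ => ENNReal.toReal_nonneg

/-- The expected numbers of transported loads stabilize at `u`, whatever the initial state. -/
def IsThroughput (u : E → ℝ) : Prop :=
  ∀ σ : FreightState E, Tendsto (M.expectedShipped r p σ) atTop (𝓝 u)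

section IntegralProfit

variable {α : Type*} [MeasurableSpace α] {μ : Measure α} [IsProbabilityMeasure μ]
  {D v : α → E → ℝ} (hD : ∀ e, Integrable (fun a => D a e) μ)
  (hv : ∀ e, Integrable (fun a => v a e) μ)
include hD hv

lemma integrable_profit : Integrable (fun a => M.profit r p (D a) (v a)) μ :=
  integrable_finsetSum _ fun e _ => ((integrable_const _).sub
    (((hD e).sub (hv e)).const_mul _)).sub ((hv e).const_mul _)

lemma integral_profit :
    ∫ a, M.profit r p (D a) (v a) ∂μ
      = M.profit r p (fun e => ∫ a, D a e ∂μ) (fun e => ∫ a, v a e ∂μ) := by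
  have hloss (e : E) : Integrable (fun a => M.penalty e * (D a e - v a e)) μ :=
    ((hD e).sub (hv e)).const_mul _
  have hsale (e : E) : Integrable
      (fun a => r e * M.demand e (r e) - M.penalty e * (D a e - v a e)) μ :=
    (integrable_const _).sub (hloss e)
  have hprofit (e : E) : Integrable
      (fun a => r e * M.demand e (r e) - M.penalty e * (D a e - v a e) - p e * v a e) μ :=
    (hsale e).sub ((hv e).const_mul _)
  simp only [profit]
  rw [integral_finsetSum _ fun e _ => hprofit e]
  refine Finset.sum_congr rfl fun e _ => ?_
  rw [integral_sub (hsale e) ((hv e).const_mul _), integral_sub (integrable_const _) (hloss e),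
    integral_const_mul (p e), integral_const_mul (M.penalty e), integral_sub (hD e) (hv e),
    integral_const, probReal_univ, one_smul]

end IntegralProfit

variable [M.IsStochastic]

lemma toReal_meanShipped_le_loads (e : E) (σ : FreightState E) :
    (M.meanShipped p e σ).toReal ≤ σ.2 e :=
  ENNReal.toReal_le_of_le_ofReal (Nat.cast_nonneg _) (by simpa using M.meanShipped_le_loads p σ e)

lemma expectedProfit_eq_profit (σ : FreightState E) :
    M.expectedProfit r p σ
      = M.profit r p (fun e => σ.2 e) (fun e => (M.meanShipped p e σ).toReal) := by
  have hshipped (e : E) : Integrable (fun X => (shipped X σ.2 e : ℝ)) (M.bookingLaw p σ.1) := by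
    refine .of_bound (C := σ.2 e) Measurable.of_discrete.aestronglyMeasurable
      (ae_of_all _ fun X => ?_)
    rw [Real.norm_natCast]
    exact Nat.cast_le.2 (min_le_right (X e) (σ.2 e))
  have hmean (e : E) :
      ∫ X, (shipped X σ.2 e : ℝ) ∂(M.bookingLaw p σ.1) = (M.meanShipped p e σ).toReal := by
    rw [integral_eq_lintegral_of_nonneg_ae (ae_of_all _ fun X => by positivity)
      Measurable.of_discrete.aestronglyMeasurable]
    simp [meanShipped]
  exact (M.integral_profit r p (D := fun _ e => σ.2 e) (fun _ => integrable_const _)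
    hshipped).trans (by simp [hmean])

lemma integrable_meanShipped_stateLaw (σ : FreightState E) (t : ℕ) (e : E) :
    Integrable (fun τ => (M.meanShipped p e τ).toReal) (M.stateLaw r p σ t) :=
  (M.integrable_loads_stateLaw r p σ t (M.integrable_eval_demandLaw r e)).mono'
    Measurable.of_discrete.aestronglyMeasurable <| ae_of_all _ fun τ => by
      simpa [abs_of_nonneg] using M.toReal_meanShipped_le_loads p e τ

lemma integrable_expectedProfit (σ : FreightState E) (t : ℕ) :
    Integrable (M.expectedProfit r p) (M.stateLaw r p σ t) :=
  (M.integrable_profit r p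
    (fun e => M.integrable_loads_stateLaw r p σ t (M.integrable_eval_demandLaw r e))
    (M.integrable_meanShipped_stateLaw r p σ t)).congr
    (ae_of_all _ fun τ => (M.expectedProfit_eq_profit r p τ).symm)

lemma integral_expectedProfit_succ (σ : FreightState E) (t : ℕ) :
    ∫ τ, M.expectedProfit r p τ ∂(M.stateLaw r p σ (t + 1))
      = M.profit r p (fun e => (M.demand e (r e)).toNNReal)
          (M.expectedShipped r p σ (t + 1)) := by
  simp_rw [expectedProfit_eq_profit]
  rw [M.integral_profit r p
    (fun e => M.integrable_loads_stateLaw r p σ _ (M.integrable_eval_demandLaw r e))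
    (M.integrable_meanShipped_stateLaw r p σ _)]
  congr 1
  ext e
  rw [← integral_eval_demandLaw, ← M.integral_loads_stateLaw_succ r p σ t fun D => (D e : ℝ)]

lemma exists_isThroughput : ∃ u, M.IsThroughput r p u := by
  choose u hu using fun e => M.exists_tendsto_integral_stateLaw r p
    (M.integrable_eval_demandLaw r e) (f := fun τ => (M.meanShipped p e τ).toReal)
    fun σ => by simpa [abs_of_nonneg] using M.toReal_meanShipped_le_loads p e σ
  exact ⟨u, fun σ => tendsto_pi_nhds.2 fun e => hu e σ⟩

variable {M r p}

lemma IsThroughput.isLongRunAverageProfit {u : E → ℝ} (hu : M.IsThroughput r p u)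
    (hd : ∀ e, 0 ≤ M.demand e (r e)) :
    M.IsLongRunAverageProfit r p (M.profit r p (fun e => M.demand e (r e)) u) := by
  refine fun σ => ⟨M.integrable_expectedProfit r p σ, ?_⟩
  have hcont : Continuous (M.profit r p fun e => M.demand e (r e)) := by
    unfold profit
    fun_prop
  have hlim : Tendsto (fun t => ∫ τ, M.expectedProfit r p τ ∂(M.stateLaw r p σ t)) atTop
      (𝓝 (M.profit r p (fun e => M.demand e (r e)) u)) := by
    refine (tendsto_add_atTop_iff_nat 1).1 (((hcont.tendsto u).comp
      ((hu σ).comp (tendsto_add_atTop_nat 1))).congr fun t => ?_)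
    simp [integral_expectedProfit_succ, hd]
  exact hlim.cesaro.congr fun T => by rw [inv_mul_eq_div]

end Throughput

section Balance

/-- The rates at which carriers return to the lanes when loads are transported at rates `v`. -/
def returnFlow : (E → ℝ) →ₗ[ℝ] E → ℝ :=
  LinearMap.pi fun e => ∑ k : E with k.1.2 = e.1.1, M.stay e • LinearMap.proj k

lemma returnFlow_apply (v : E → ℝ) (e : E) :
    M.returnFlow v e = ∑ k : E with k.1.2 = e.1.1, M.stay e * v k := by
  simp [returnFlow]

variable [hM : M.IsStochastic]

lemma monotone_returnFlow : Monotone M.returnFlow := fun v w hvw e => by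
  simp only [returnFlow_apply]
  gcongr with k
  · exact hM.stay_nonneg e
  · exact hvw k

lemma lintegral_meanShipped_stateLaw (r p : E → ℝ) (σ : FreightState E) (t : ℕ) (e : E) :
    ∫⁻ τ, M.meanShipped p e τ ∂(M.stateLaw r p σ t)
      = ENNReal.ofReal (M.expectedShipped r p σ t e) := by
  rw [expectedShipped, ofReal_integral_eq_lintegral_ofReal
    (M.integrable_meanShipped_stateLaw r p σ t e) (ae_of_all _ fun _ => ENNReal.toReal_nonneg)]
  exact lintegral_congr fun τ => (ENNReal.ofReal_toReal
    (ne_top_of_le_ne_top (by simp) (M.meanShipped_le_loads p τ e))).symm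

lemma returnFlow_nonneg {v : E → ℝ} (hv : 0 ≤ v) : 0 ≤ M.returnFlow v := by
  simpa using M.monotone_returnFlow hv

variable {M} {r p : E → ℝ}

lemma lintegral_carriers_stateLaw_succ (harr : ∀ e, 0 ≤ M.arrival e) (σ : FreightState E) (t : ℕ)
    (e : E) :
    ∫⁻ τ, (τ.1 e : ℝ≥0∞) ∂(M.stateLaw r p σ (t + 1))
      = ENNReal.ofReal (M.returnFlow (M.expectedShipped r p σ t) e + M.arrival e) := by
  have hflow : ∑ k : E with k.1.2 = e.1.1, ((M.stay e).toNNReal : ℝ≥0∞)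
        * ENNReal.ofReal (M.expectedShipped r p σ t k)
      = ENNReal.ofReal (M.returnFlow (M.expectedShipped r p σ t) e) := by
    rw [returnFlow_apply, ENNReal.ofReal_sum_of_nonneg fun k _ =>
      mul_nonneg (hM.stay_nonneg e) (M.expectedShipped_nonneg r p σ t k)]
    exact Finset.sum_congr rfl fun k _ => (ENNReal.ofReal_mul (hM.stay_nonneg e)).symm
  rw [← lintegral_map (f := fun S : E → ℕ => (S e : ℝ≥0∞)) .of_discrete measurable_fst,
    map_fst_stateLaw_succ, Measure.lintegral_bind Measurable.of_discrete.aemeasurable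
    Measurable.of_discrete.aemeasurable]
  simp_rw [lintegral_eval_carrierLaw]
  rw [lintegral_add_right _ measurable_const, lintegral_finsetSum _ fun _ _ => .of_discrete]
  simp_rw [lintegral_const_mul _ Measurable.of_discrete, lintegral_meanShipped_stateLaw]
  rw [hflow, lintegral_const, measure_univ, mul_one, ENNReal.ofReal_add
    (M.returnFlow_nonneg (M.expectedShipped_nonneg r p σ t) e) (harr e)]
  rfl

lemma expectedShipped_succ_le (harr : ∀ e, 0 ≤ M.arrival e) (σ : FreightState E) (t : ℕ) (e : E) :
    M.expectedShipped r p σ (t + 1) e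
      ≤ M.acceptProb p e * (M.returnFlow (M.expectedShipped r p σ t) e + M.arrival e) := by
  have hinflow : 0 ≤ M.returnFlow (M.expectedShipped r p σ t) e + M.arrival e :=
    add_nonneg (M.returnFlow_nonneg (M.expectedShipped_nonneg r p σ t) e) (harr e)
  rw [← ENNReal.ofReal_le_ofReal_iff (by positivity), ← lintegral_meanShipped_stateLaw,
    ENNReal.ofReal_mul (by positivity), ENNReal.ofReal_coe_nnreal,
    ← lintegral_carriers_stateLaw_succ harr, ← lintegral_const_mul _ .of_discrete]
  exact lintegral_mono fun τ => M.meanShipped_le_accept p τ e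

end Balance

section Equilibrium

/-- Flows `y` of transported loads that prices `(r, p)` sustain without randomness: on each lane a
fraction `acceptProb` of the returning and newly arriving carriers books, which the demand can
absorb. -/
structure IsFluidEquilibrium (r p y : E → ℝ) : Prop where
  balance : ∀ e, M.acceptProb p e * (M.returnFlow y e + M.arrival e) = y e
  nonneg : 0 ≤ y
  le_demand : ∀ e, y e ≤ M.demand e (r e)

variable {M} [hM : M.IsStochastic] {r p y : E → ℝ}

lemma sum_mul_acceptProb_mul_sum (h : M.IsFluidEquilibrium r p y) (x : E → ℝ≥0) :
    ∑ k : E, (M.returnFlow y k + M.arrival k)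
        * (M.acceptProb p k * ∑ e : E with e.1.1 = k.1.2, (M.stay e).toNNReal * x e : ℝ≥0)
      = ∑ e, M.returnFlow y e * x e := by
  have hlane (k : E) : (M.returnFlow y k + M.arrival k)
        * (M.acceptProb p k * ∑ e : E with e.1.1 = k.1.2, (M.stay e).toNNReal * x e : ℝ≥0)
      = ∑ e : E, if k.1.2 = e.1.1 then M.stay e * y k * x e else 0 := by
    push_cast
    rw [← mul_assoc, mul_comm (_ + _), h.balance, Finset.mul_sum, Finset.sum_filter]
    refine Finset.sum_congr rfl fun e _ => ?_
    rw [Real.coe_toNNReal _ (hM.stay_nonneg e)]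
    by_cases hk : k.1.2 = e.1.1
    · simp only [hk, if_true]
      ring
    · simp [hk, Ne.symm hk]
  simp_rw [hlane]
  rw [Finset.sum_comm]
  exact Finset.sum_congr rfl fun e _ => by
    rw [returnFlow_apply, Finset.sum_mul, Finset.sum_filter]

lemma IsFluidEquilibrium.factorialMGF_carriers_le (h : M.IsFluidEquilibrium r p y)
    (harr : ∀ e, 0 ≤ M.arrival e) (t : ℕ) (x : E → ℝ≥0) :
    factorialMGF ((M.stateLaw r p 0 t).map Prod.fst) x
      ≤ ENNReal.ofReal (Real.exp (∑ e, (M.returnFlow y e + M.arrival e) * x e)) := by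
  induction t generalizing x with
  | zero =>
    rw [stateLaw, Measure.map_dirac' measurable_fst, factorialMGF_dirac]
    simpa using Finset.sum_nonneg fun e _ => mul_nonneg
      (add_nonneg (M.returnFlow_nonneg h.nonneg e) (harr e)) (x e).2
  | succ t ih =>
    have hmap (x : E → ℝ≥0) : ∫⁻ τ, ∏ k, (1 + x k : ℝ≥0∞) ^ τ.1 k ∂(M.stateLaw r p 0 t)
        = factorialMGF ((M.stateLaw r p 0 t).map Prod.fst) x :=
      (lintegral_map (f := fun S : E → ℕ => ∏ k, (1 + x k : ℝ≥0∞) ^ S k) .of_discrete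
        measurable_fst).symm
    rw [map_fst_stateLaw_succ, factorialMGF_bind .of_discrete]
    refine (lintegral_mono fun τ => M.factorialMGF_carrierLaw_le p τ x).trans ?_
    rw [lintegral_mul_const _ .of_discrete, hmap]
    refine (mul_le_mul_left (ih _) _).trans_eq ?_
    rw [← ENNReal.ofReal_mul (by positivity), ← Real.exp_add, sum_mul_acceptProb_mul_sum h,
      ← Finset.sum_add_distrib]
    simp_rw [Real.coe_toNNReal _ (harr _), ← add_mul]

lemma IsFluidEquilibrium.lintegral_pow_carriers_le (h : M.IsFluidEquilibrium r p y)
    (harr : ∀ e, 0 ≤ M.arrival e) (t : ℕ) (e : E) (x : ℝ≥0) :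
    ∫⁻ S, (1 + x : ℝ≥0∞) ^ S e ∂((M.stateLaw r p 0 t).map Prod.fst)
      ≤ ENNReal.ofReal (Real.exp ((M.returnFlow y e + M.arrival e) * x)) := by
  have hsum : ∑ i, (M.returnFlow y i + M.arrival i) * ((Pi.single e x : E → ℝ≥0) i : ℝ)
      = (M.returnFlow y e + M.arrival e) * x := by
    rw [Finset.sum_eq_single e] <;> simp +contextual
  rw [← factorialMGF_single, ← hsum]
  exact h.factorialMGF_carriers_le harr t _

variable {s : ℝ}

lemma acceptProb_mul_carriers_le (hs : 0 < s) (e : E) (σ : FreightState E) :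
    (M.acceptProb p e : ℝ≥0∞) * σ.1 e ≤ M.meanShipped p e σ + ENNReal.ofReal s⁻¹
      * ((1 + (M.acceptProb p e * (Real.exp s - 1).toNNReal : ℝ≥0) : ℝ≥0∞) ^ σ.1 e
        * ENNReal.ofReal (Real.exp (-s)) ^ σ.2 e) := by
  have hbookings : ∫⁻ X, ENNReal.ofReal (Real.exp s) ^ X e ∂(M.bookingLaw p σ.1)
      = (1 + (M.acceptProb p e * (Real.exp s - 1).toNNReal : ℝ≥0) : ℝ≥0∞) ^ σ.1 e := by
    rw [ofReal_exp_eq_one_add hs.le, ← factorialMGF_single, factorialMGF_bookingLaw,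
      Finset.prod_eq_single e] <;> simp +contextual
  rw [← hbookings, ← lintegral_eval_bookingLaw, ← lintegral_mul_const _ .of_discrete,
    ← lintegral_const_mul _ .of_discrete, meanShipped, ← lintegral_add_left .of_discrete]
  exact lintegral_mono fun X => natCast_le_min_add_exp hs (X e) (σ.2 e)

/- The Poisson demand is independent of the carriers, who are dominated by a Poisson variable; of
the exponent only `d * (exp s - 1 + exp (-s) - 1)` survives, which is quadratic in `s`. -/
lemma IsFluidEquilibrium.lintegral_exp_excess_le (h : M.IsFluidEquilibrium r p y)
    (harr : ∀ e, 0 ≤ M.arrival e) (hs : 0 < s) (hs1 : s ≤ 1) (t : ℕ) (e : E) :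
    ∫⁻ τ, (1 + (M.acceptProb p e * (Real.exp s - 1).toNNReal : ℝ≥0) : ℝ≥0∞) ^ τ.1 e
        * ENNReal.ofReal (Real.exp (-s)) ^ τ.2 e ∂(M.stateLaw r p 0 (t + 1))
      ≤ ENNReal.ofReal (Real.exp (M.demand e (r e) * (2 * s ^ 2))) := by
  have hd : 0 ≤ M.demand e (r e) := (h.nonneg e).trans (h.le_demand e)
  have hexp : 0 ≤ Real.exp s - 1 := sub_nonneg.2 (Real.one_le_exp hs.le)
  rw [stateLaw_succ, ← map_fst_stateLaw_succ]
  refine (lintegral_prod_mul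
    (f := fun S : E → ℕ => (1 + (M.acceptProb p e * (Real.exp s - 1).toNNReal : ℝ≥0) : ℝ≥0∞) ^ S e)
    (g := fun D : E → ℕ => ENNReal.ofReal (Real.exp (-s)) ^ D e) Measurable.of_discrete.aemeasurable
    Measurable.of_discrete.aemeasurable).trans_le ?_
  refine (mul_le_mul' (h.lintegral_pow_carriers_le harr _ e _)
    (M.lintegral_pow_eval_demandLaw r e _).le).trans ?_
  rw [← ENNReal.ofReal_mul (by positivity), ← Real.exp_add]
  refine ENNReal.ofReal_le_ofReal (Real.exp_le_exp.2 ?_)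
  rw [NNReal.coe_mul, ← mul_assoc, mul_comm (_ + _), h.balance, Real.coe_toNNReal _ hexp,
    Real.coe_toNNReal _ hd, Real.coe_toNNReal _ (Real.exp_pos _).le]
  calc y e * (Real.exp s - 1) + M.demand e (r e) * (Real.exp (-s) - 1)
      ≤ M.demand e (r e) * (Real.exp s - 1) + M.demand e (r e) * (Real.exp (-s) - 1) := by
        gcongr
        exact h.le_demand e
    _ = M.demand e (r e) * ((Real.exp s - 1) + (Real.exp (-s) - 1)) := by ring
    _ ≤ M.demand e (r e) * (2 * s ^ 2) := by
        gcongr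
        exact exp_sub_one_add_exp_neg_sub_one_le (abs_le.2 ⟨by linarith, hs1⟩)

lemma IsFluidEquilibrium.le_expectedShipped_succ_add (h : M.IsFluidEquilibrium r p y)
    (harr : ∀ e, 0 ≤ M.arrival e) (hs : 0 < s) (hs1 : s ≤ 1) (t : ℕ) (e : E) :
    M.acceptProb p e * (M.returnFlow (M.expectedShipped r p 0 t) e + M.arrival e)
      ≤ M.expectedShipped r p 0 (t + 1) e
        + s⁻¹ * Real.exp (M.demand e (r e) * (2 * s ^ 2)) := by
  have hnonneg := M.expectedShipped_nonneg r p 0 (t + 1) e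
  rw [← ENNReal.ofReal_le_ofReal_iff (add_nonneg hnonneg (by positivity)),
    ENNReal.ofReal_mul (by positivity), ENNReal.ofReal_coe_nnreal,
    ← lintegral_carriers_stateLaw_succ harr, ← lintegral_const_mul _ .of_discrete,
    ENNReal.ofReal_add hnonneg (by positivity),
    ← lintegral_meanShipped_stateLaw, ENNReal.ofReal_mul (by positivity)]
  refine (lintegral_mono fun τ => acceptProb_mul_carriers_le hs e τ).trans ?_
  rw [lintegral_add_left .of_discrete, lintegral_const_mul _ .of_discrete]
  gcongr
  exact h.lintegral_exp_excess_le harr hs hs1 t e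

end Equilibrium

section Gap

variable {M} {r p u y : E → ℝ} {s η κ : ℝ}

lemma abs_profit_sub_profit_le {D : E → ℝ} (huy : u ≤ y) (hκ : y - u ≤ κ • y) :
    |M.profit r p D y - M.profit r p D u| ≤ κ * ∑ e, |M.penalty e - p e| * y e := by
  have hdiff : M.profit r p D y - M.profit r p D u
      = ∑ e, (M.penalty e - p e) * (y e - u e) := by
    rw [profit, profit, ← Finset.sum_sub_distrib]
    exact Finset.sum_congr rfl fun e _ => by ring
  rw [hdiff, Finset.mul_sum]
  refine (Finset.abs_sum_le_sum_abs _ _).trans (Finset.sum_le_sum fun e _ => ?_)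
  rw [abs_mul, abs_of_nonneg (sub_nonneg.2 (huy e)), mul_left_comm]
  gcongr
  exact hκ e

variable (M p) in
/-- The rates at which loads are transported by carriers who return after transporting loads at
rates `v`, if all of those who accept the price find a load. -/
noncomputable def rebookedFlow : (E → ℝ) →ₗ[ℝ] E → ℝ :=
  LinearMap.pi fun e => (M.acceptProb p e : ℝ) • LinearMap.proj e ∘ₗ M.returnFlow

lemma rebookedFlow_apply (v : E → ℝ) (e : E) :
    M.rebookedFlow p v e = M.acceptProb p e * M.returnFlow v e := by
  simp [rebookedFlow]

lemma IsThroughput.nonneg (hu : M.IsThroughput r p u) : 0 ≤ u :=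
  ge_of_tendsto' (hu 0) (M.expectedShipped_nonneg r p 0)

lemma IsThroughput.tendsto_accepting (hu : M.IsThroughput r p u) (e : E) :
    Tendsto (fun t => M.acceptProb p e * (M.returnFlow (M.expectedShipped r p 0 t) e
      + M.arrival e)) atTop (𝓝 (M.rebookedFlow p u e + M.acceptProb p e * M.arrival e)) := by
  have hcont : Continuous fun v => M.acceptProb p e * (M.returnFlow v e + M.arrival e) := by
    have := M.returnFlow.continuous_of_finiteDimensional
    fun_prop
  simpa only [rebookedFlow_apply, mul_add, Function.comp_def] using (hcont.tendsto u).comp (hu 0)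

lemma IsFluidEquilibrium.rebookedFlow_add (h : M.IsFluidEquilibrium r p y) (e : E) :
    M.rebookedFlow p y e + M.acceptProb p e * M.arrival e = y e := by
  rw [rebookedFlow_apply, ← mul_add, h.balance]

lemma IsFluidEquilibrium.rebookedFlow_le (h : M.IsFluidEquilibrium r p y)
    (hη : ∀ e, η * (M.returnFlow y e + M.arrival e) ≤ M.arrival e) :
    M.rebookedFlow p y ≤ (1 - η) • y := fun e => by
  have hnew : η * y e ≤ M.acceptProb p e * M.arrival e := by
    rw [← h.balance, mul_left_comm]
    exact mul_le_mul_of_nonneg_left (hη e) (NNReal.coe_nonneg _)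
  rw [Pi.smul_apply, smul_eq_mul, sub_mul, one_mul, le_sub_iff_add_le]
  exact (add_le_add_right hnew _).trans_eq (h.rebookedFlow_add e)

variable [M.IsStochastic]

lemma monotone_rebookedFlow : Monotone (M.rebookedFlow p) := fun v w hvw e => by
  simp only [rebookedFlow_apply]
  gcongr
  exact M.monotone_returnFlow hvw e

lemma IsThroughput.le_rebookedFlow_add (hu : M.IsThroughput r p u)
    (harr : ∀ e, 0 ≤ M.arrival e) (e : E) :
    u e ≤ M.rebookedFlow p u e + M.acceptProb p e * M.arrival e :=
  le_of_tendsto_of_tendsto' ((tendsto_pi_nhds.1 (hu 0) e).comp (tendsto_add_atTop_nat 1))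
    (hu.tendsto_accepting e) fun t => expectedShipped_succ_le harr 0 t e

namespace IsFluidEquilibrium

lemma rebookedFlow_throughput_add_le (h : M.IsFluidEquilibrium r p y)
    (hu : M.IsThroughput r p u) (harr : ∀ e, 0 ≤ M.arrival e) (hs : 0 < s) (hs1 : s ≤ 1) (e : E) :
    M.rebookedFlow p u e + M.acceptProb p e * M.arrival e
      ≤ u e + s⁻¹ * Real.exp (M.demand e (r e) * (2 * s ^ 2)) :=
  le_of_tendsto_of_tendsto' (hu.tendsto_accepting e)
    (((tendsto_pi_nhds.1 (hu 0) e).comp (tendsto_add_atTop_nat 1)).add_const _)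
    fun t => h.le_expectedShipped_succ_add harr hs hs1 t e

lemma throughput_le (h : M.IsFluidEquilibrium r p y) (hu : M.IsThroughput r p u)
    (harr : ∀ e, 0 < M.arrival e) (hη0 : 0 < η)
    (hη : ∀ e, η * (M.returnFlow y e + M.arrival e) ≤ M.arrival e) : u ≤ y := by
  have hle (e : E) : u e - y e ≤ M.rebookedFlow p (u - y) e + 0 := by
    rw [map_sub, Pi.sub_apply]
    linarith [hu.le_rebookedFlow_add (fun e => (harr e).le) e, h.rebookedFlow_add e]
  have hzero (e : E) (hy : y e = 0) : u e - y e ≤ 0 := by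
    have hinflow : 0 < M.returnFlow y e + M.arrival e :=
      add_pos_of_nonneg_of_pos (M.returnFlow_nonneg h.nonneg e) (harr e)
    have hα : (M.acceptProb p e : ℝ) = 0 :=
      (mul_eq_zero.1 ((h.balance e).trans hy)).resolve_right hinflow.ne'
    have hu := hu.le_rebookedFlow_add (fun e => (harr e).le) e
    rw [rebookedFlow_apply, hα] at hu
    linarith
  have hgap : u - y ≤ (0 : ℝ) • y := le_smul_of_le_map_add monotone_rebookedFlow hη0 le_rfl
    h.nonneg (h.rebookedFlow_le hη) hle (fun e _ => by simp) hzero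
  rwa [zero_smul, sub_nonpos] at hgap

lemma sub_throughput_le_smul (h : M.IsFluidEquilibrium r p y) (hu : M.IsThroughput r p u)
    (harr : ∀ e, 0 ≤ M.arrival e) (hη0 : 0 < η)
    (hη : ∀ e, η * (M.returnFlow y e + M.arrival e) ≤ M.arrival e) (hs : 0 < s) (hs1 : s ≤ 1)
    (hκ0 : 0 ≤ κ) (hκ : ∀ e, 0 < y e →
      s⁻¹ * Real.exp (M.demand e (r e) * (2 * s ^ 2)) ≤ η * (κ * y e)) :
    y - u ≤ κ • y := by
  have hle (e : E) : y e - u e ≤ M.rebookedFlow p (y - u) e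
      + s⁻¹ * Real.exp (M.demand e (r e) * (2 * s ^ 2)) := by
    rw [map_sub, Pi.sub_apply]
    linarith [h.rebookedFlow_throughput_add_le hu harr hs hs1 e, h.rebookedFlow_add e]
  refine le_smul_of_le_map_add monotone_rebookedFlow hη0 hκ0 h.nonneg (h.rebookedFlow_le hη) hle
    hκ fun e hy => ?_
  rw [Pi.sub_apply, hy, zero_sub, neg_nonpos]
  exact hu.nonneg e

end IsFluidEquilibrium

end Gap

section FluidPoint

variable {M} {z : FluidPoint E} {e : E} {θ : ℝ}

lemma demand_invDemand {d : ℝ} (hd : d ∈ M.demand e '' M.priceSet e) :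
    M.demand e (M.invDemand e d) = d :=
  Function.invFunOn_eq hd

lemma FluidFeasible.demand_shipperPrice (hz : M.FluidFeasible z) (e : E) :
    M.demand e (M.shipperPrice z e) = z.d e :=
  demand_invDemand (hz.d_mem e)

lemma FluidFeasible.fluidObjective_eq_profit (hz : M.FluidFeasible z) :
    M.fluidObjective z = M.profit (M.shipperPrice z) (M.carrierPrice z)
      (fun e => M.demand e (M.shipperPrice z e)) z.y := by
  refine Finset.sum_congr rfl fun e _ => ?_
  simp only [hz.demand_shipperPrice]
  rw [shipperPrice, carrierPrice]
  ring

lemma FluidFeasible.returnFlow_add_arrival (hz : M.FluidFeasible z) (e : E) :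
    M.returnFlow z.y e + M.arrival e = z.lam e := by
  rw [returnFlow_apply, hz.flow]

lemma costCDF_costQuantile (hcost : M.costCDF e 0 = 0) {x : ℝ}
    (hx : x ∈ Set.range (M.costCDF e)) : M.costCDF e (M.costQuantile e x) = x := by
  have hmono : Monotone (M.costCDF e) := monotone_cdf _
  obtain ⟨c, hc0, rfl⟩ : ∃ c, 0 ≤ c ∧ M.costCDF e c = x := by
    obtain ⟨c, rfl⟩ := hx
    rcases le_total 0 c with h | h
    · exact ⟨c, h, rfl⟩
    · exact ⟨0, le_rfl, le_antisymm (hcost.trans_le (cdf_nonneg _ _)) (hmono h)⟩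
  have hmem : c ∈ {b | 0 ≤ b ∧ M.costCDF e c ≤ M.costCDF e b} := ⟨hc0, le_rfl⟩
  refine le_antisymm (hmono (csInf_le ⟨0, fun _ h => h.1⟩ hmem)) ?_
  have hright : Tendsto (M.costCDF e) (𝓝[>] M.costQuantile e (M.costCDF e c))
      (𝓝 (M.costCDF e (M.costQuantile e (M.costCDF e c)))) :=
    ((cdf (M.costLaw e)).right_continuous _).tendsto.mono_left
      (nhdsWithin_mono _ Set.Ioi_subset_Ici_self)
  refine ge_of_tendsto hright (eventually_nhdsWithin_of_forall fun a ha => ?_)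
  obtain ⟨b, hb, hba⟩ := exists_lt_of_csInf_lt ⟨c, hmem⟩ ha
  exact hb.2.trans (hmono hba.le)

/-- A candidate of the fluid problem with all quantities multiplied by `θ`, for comparing the
fluid problems of a market and of its scaled versions. -/
@[simps]
def scalePoint (θ : ℝ) (z : FluidPoint E) : FluidPoint E where
  d e := θ * z.d e
  y e := θ * z.y e
  lam e := θ * z.lam e

lemma scalePoint_inv_smul (hθ : θ ≠ 0) (z : FluidPoint E) :
    scalePoint θ (scalePoint θ⁻¹ z) = z := by
  simp [scalePoint, mul_inv_cancel_left₀ hθ]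

lemma scale_scale_inv (hθ : θ ≠ 0) : (M.scale θ).scale θ⁻¹ = M := by
  simp [scale, inv_mul_cancel_left₀ hθ]

lemma mul_mem_demand_scale {d : ℝ} (hd : d ∈ M.demand e '' M.priceSet e) :
    θ * d ∈ (M.scale θ).demand e '' (M.scale θ).priceSet e :=
  hd.imp fun _ h => ⟨h.1, congrArg (θ * ·) h.2⟩

lemma FluidFeasible.scale (hz : M.FluidFeasible z) (hθ : 0 < θ) :
    (M.scale θ).FluidFeasible (scalePoint θ z) where
  flow e := by
    simp only [scalePoint_y, scalePoint_lam, FreightMarket.scale]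
    simp_rw [mul_left_comm _ θ]
    rw [← Finset.mul_sum, ← mul_add, hz.flow]
  y_le_d e := mul_le_mul_of_nonneg_left (hz.y_le_d e) hθ.le
  y_le_lam e := mul_le_mul_of_nonneg_left (hz.y_le_lam e) hθ.le
  y_nonneg e := mul_nonneg hθ.le (hz.y_nonneg e)
  lam_nonneg e := mul_nonneg hθ.le (hz.lam_nonneg e)
  d_nonneg e := mul_nonneg hθ.le (hz.d_nonneg e)
  d_mem e := mul_mem_demand_scale (hz.d_mem e)
  ratio_mem e := by
    rw [scalePoint_y, scalePoint_lam, mul_div_mul_left _ _ hθ.ne']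
    exact hz.ratio_mem e

lemma carrierPrice_scale (hθ : θ ≠ 0) :
    (M.scale θ).carrierPrice (scalePoint θ z) = M.carrierPrice z := by
  ext e
  simp only [carrierPrice, scalePoint_y, scalePoint_lam, mul_div_mul_left _ _ hθ]
  rfl

section InjOn

variable (hdemand : ∀ e, Set.InjOn (M.demand e) (M.priceSet e))
include hdemand

lemma FluidFeasible.shipperPrice_scale (hz : M.FluidFeasible z) (hθ : θ ≠ 0) :
    (M.scale θ).shipperPrice (scalePoint θ z) = M.shipperPrice z := by
  ext e
  have hscaled := mul_mem_demand_scale (θ := θ) (hz.d_mem e)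
  refine hdemand e (Function.invFunOn_mem hscaled) (Function.invFunOn_mem (hz.d_mem e)) ?_
  rw [hz.demand_shipperPrice]
  exact mul_left_cancel₀ hθ (demand_invDemand hscaled)

lemma FluidFeasible.fluidObjective_scale (hz : M.FluidFeasible z) (hθ : 0 < θ) :
    (M.scale θ).fluidObjective (scalePoint θ z) = θ * M.fluidObjective z := by
  rw [(hz.scale hθ).fluidObjective_eq_profit, hz.fluidObjective_eq_profit,
    hz.shipperPrice_scale hdemand hθ.ne', carrierPrice_scale hθ.ne', profit, profit,
    Finset.mul_sum]
  refine Finset.sum_congr rfl fun e _ => ?_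
  simp only [FreightMarket.scale, scalePoint_y]
  ring

lemma IsFluidOptimal.scale (hz : M.IsFluidOptimal z) (hθ : 0 < θ) :
    (M.scale θ).IsFluidOptimal (scalePoint θ z) := by
  refine ⟨hz.1.scale hθ, fun w hw => ?_⟩
  have hw' : M.FluidFeasible (scalePoint θ⁻¹ w) := by
    simpa only [scale_scale_inv hθ.ne'] using hw.scale (inv_pos.2 hθ)
  rw [← scalePoint_inv_smul hθ.ne' w, hw'.fluidObjective_scale hdemand hθ,
    hz.1.fluidObjective_scale hdemand hθ]
  exact mul_le_mul_of_nonneg_left (hz.2 _ hw') hθ.le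

end InjOn

lemma IsFluidOptimal.fluidValue_eq (hz : M.IsFluidOptimal z) :
    M.fluidValue = M.fluidObjective z :=
  IsGreatest.csSup_eq ⟨Set.mem_image_of_mem _ hz.1, Set.forall_mem_image.2 hz.2⟩

lemma IsFluidOptimal.fluidValue_scale (hz : M.IsFluidOptimal z)
    (hdemand : ∀ e, Set.InjOn (M.demand e) (M.priceSet e)) (hθ : 0 < θ) :
    (M.scale θ).fluidValue = θ * M.fluidValue := by
  rw [(hz.scale hdemand hθ).fluidValue_eq, hz.1.fluidObjective_scale hdemand hθ, hz.fluidValue_eq]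

end FluidPoint

section StaticPrices

variable {M} [M.IsStochastic] {z : FluidPoint E} (hz : M.FluidFeasible z)
  (harr : ∀ e, 0 < M.arrival e) (hcost : ∀ e, M.costCDF e 0 = 0)

include hz in
lemma FluidFeasible.acceptProb_carrierPrice {e : E} (hcost : M.costCDF e 0 = 0) :
    (M.acceptProb (M.carrierPrice z) e : ℝ) = z.y e / z.lam e := by
  rw [← costCDF_costQuantile hcost (hz.ratio_mem e), costCDF, cdf_eq_real]
  rfl

include hz harr hcost

lemma FluidFeasible.isFluidEquilibrium :
    M.IsFluidEquilibrium (M.shipperPrice z) (M.carrierPrice z) z.y where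
  balance e := by
    have hlam : 0 < z.lam e := by
      rw [← hz.returnFlow_add_arrival]
      exact add_pos_of_nonneg_of_pos (M.returnFlow_nonneg hz.y_nonneg e) (harr e)
    rw [hz.returnFlow_add_arrival, hz.acceptProb_carrierPrice (hcost e),
      div_mul_cancel₀ _ hlam.ne']
  nonneg := hz.y_nonneg
  le_demand e := (hz.y_le_d e).trans_eq (hz.demand_shipperPrice e).symm

lemma FluidFeasible.abs_fluidObjective_sub_profit_le {u : E → ℝ} {s η κ : ℝ}
    (hu : M.IsThroughput (M.shipperPrice z) (M.carrierPrice z) u) (hη0 : 0 < η)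
    (hη : ∀ e, η * z.lam e ≤ M.arrival e) (hs : 0 < s) (hs1 : s ≤ 1) (hκ0 : 0 ≤ κ)
    (hκ : ∀ e, 0 < z.y e → s⁻¹ * Real.exp (z.d e * (2 * s ^ 2)) ≤ η * (κ * z.y e)) :
    |M.fluidObjective z - M.profit (M.shipperPrice z) (M.carrierPrice z)
        (fun e => M.demand e (M.shipperPrice z e)) u|
      ≤ κ * ∑ e, |M.penalty e - M.carrierPrice z e| * z.y e := by
  have h := hz.isFluidEquilibrium harr hcost
  simp only [← hz.returnFlow_add_arrival] at hη
  simp only [← hz.demand_shipperPrice] at hκ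
  rw [hz.fluidObjective_eq_profit]
  exact abs_profit_sub_profit_le (h.throughput_le hu harr hη0 hη)
    (h.sub_throughput_le_smul hu (fun e => (harr e).le) hη0 hη hs hs1 hκ0 hκ)

end StaticPrices
section Gap

variable {M} [M.IsStochastic] {z : FluidPoint E} {u : ℝ → E → ℝ}

lemma FluidFeasible.exists_abs_sub_profit_le_sqrt (hz : M.FluidFeasible z)
    (harr : ∀ e, 0 < M.arrival e) (hcost : ∀ e, M.costCDF e 0 = 0)
    (hdemand : ∀ e, Set.InjOn (M.demand e) (M.priceSet e))
    (hu : ∀ θ, (M.scale θ).IsThroughput (M.shipperPrice z) (M.carrierPrice z) (u θ)) :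
    ∃ C : ℝ, ∀ θ : ℝ, 1 ≤ θ → |θ * M.fluidObjective z
      - (M.scale θ).profit (M.shipperPrice z) (M.carrierPrice z)
          (fun e => (M.scale θ).demand e (M.shipperPrice z e)) (u θ)| ≤ C * √θ := by
  obtain ⟨η, hη0, hη⟩ := exists_pos_mul_le z.lam harr
  obtain ⟨K, hK0, hK⟩ := exists_nonneg_le_mul (fun e => Real.exp (2 * z.d e)) (fun e => η * z.y e)
  refine ⟨K * ∑ e, |M.penalty e - M.carrierPrice z e| * z.y e, fun θ hθ => ?_⟩
  have hθ0 : 0 < θ := zero_lt_one.trans_le hθ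
  have hsqrt : 0 < √θ := Real.sqrt_pos.2 hθ0
  have hinflow (e : E) : η * (scalePoint θ z).lam e ≤ (M.scale θ).arrival e := by
    rw [scalePoint_lam, mul_left_comm]
    exact mul_le_mul_of_nonneg_left (hη e) hθ0.le
  have hexcess (e : E) (hy : 0 < (scalePoint θ z).y e) :
      (√θ)⁻¹⁻¹ * Real.exp ((scalePoint θ z).d e * (2 * (√θ)⁻¹ ^ 2))
        ≤ η * (K / √θ * (scalePoint θ z).y e) := by
    rw [scalePoint_y, mul_pos_iff_of_pos_left hθ0] at hy
    exact inv_inv_sqrt_mul_exp_le hθ0 (hK e (mul_pos hη0 hy))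
  have hbound := (hz.scale hθ0).abs_fluidObjective_sub_profit_le (u := u θ) (κ := K / √θ)
    (fun e => mul_pos hθ0 (harr e)) hcost
    (by rw [hz.shipperPrice_scale hdemand hθ0.ne', carrierPrice_scale hθ0.ne']; exact hu θ)
    hη0 hinflow (inv_pos.2 hsqrt) (inv_le_one_of_one_le₀ (Real.one_le_sqrt.2 hθ))
    (by positivity) hexcess
  rw [hz.fluidObjective_scale hdemand hθ0, hz.shipperPrice_scale hdemand hθ0.ne',
    carrierPrice_scale hθ0.ne'] at hbound
  refine hbound.trans_eq ?_
  simp only [scalePoint_y, mul_left_comm _ θ, ← Finset.mul_sum]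
  change θ * (K / √θ * ∑ e, |M.penalty e - M.carrierPrice z e| * z.y e) = _
  nth_rw 1 [← Real.sq_sqrt hθ0.le]
  field_simp

end Gap

lemma IsRegular.isStochastic {M : FreightMarket E} (hM : M.IsRegular) : M.IsStochastic :=
  ⟨hM.stay_nonneg, hM.stay_sum_le_one, hM.cost_prob⟩

lemma IsRegular.costCDF_zero {M : FreightMarket E} (hM : M.IsRegular) (e : E) :
    M.costCDF e 0 = 0 := by
  have := hM.cost_prob e
  have hneg : M.costLaw e (Set.Iic 0) = 0 := by
    rw [← Set.Iio_union_right, measure_union_null_iff]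
    exact ⟨hM.cost_nonneg e, hM.cost_density e (by simp)⟩
  rw [costCDF, cdf_eq_real, measureReal_def, hneg, ENNReal.toReal_zero]

end FreightMarket

theorem theorem2_general {n : ℕ} {E : Finset (Fin n × Fin n)} (M : FreightMarket E)
    [M.IsStochastic] (harr : ∀ e, 0 < M.arrival e) (hcost : ∀ e, M.costCDF e 0 = 0)
    (hdemand : ∀ e, Set.InjOn (M.demand e) (M.priceSet e)) {z : FluidPoint E}
    (hz : M.IsFluidOptimal z) (hpos : 0 < M.fluidValue) :
    ∃ γSP : ℝ → ℝ,
      (∀ θ, 0 < θ →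
        (M.scale θ).IsLongRunAverageProfit (M.shipperPrice z) (M.carrierPrice z) (γSP θ)) ∧
      (∃ C : ℝ, ∀ θ, 1 ≤ θ → |(M.scale θ).fluidValue - γSP θ| ≤ C * √θ) ∧
      (fun θ => 1 - γSP θ / (M.scale θ).fluidValue) =O[atTop] (fun θ => 1 / √θ) ∧
      Tendsto (fun θ => γSP θ / (M.scale θ).fluidValue) atTop (𝓝 1) := by
  choose u hu using fun θ : ℝ =>
    (M.scale θ).exists_isThroughput (M.shipperPrice z) (M.carrierPrice z)
  obtain ⟨C, hC⟩ := hz.1.exists_abs_sub_profit_le_sqrt harr hcost hdemand hu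
  have hvalue (θ : ℝ) (hθ : 1 ≤ θ) : (M.scale θ).fluidValue = θ * M.fluidValue :=
    hz.fluidValue_scale hdemand (zero_lt_one.trans_le hθ)
  have hgap (θ : ℝ) (hθ : 1 ≤ θ) := by
    simpa only [← hz.fluidValue_eq, ← hvalue θ hθ] using hC θ hθ
  have hratio := isBigO_one_sub_div_of_abs_sub_le hpos hvalue hgap
  refine ⟨_, fun θ hθ => (hu θ).isLongRunAverageProfit fun e => mul_nonneg hθ.le ?_, ⟨C, hgap⟩,
    hratio, tendsto_of_isBigO_one_sub hratio⟩
  exact (hz.1.d_nonneg e).trans_eq (hz.1.demand_shipperPrice e).symm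

theorem theorem2 {n : ℕ} {E : Finset (Fin n × Fin n)} (M : FreightMarket E) (hM : M.IsRegular)
    (z : FluidPoint E) (hz : M.IsFluidOptimal z) (hpos : 0 < M.fluidValue) :
    ∃ γSP : ℕ → ℝ,
      (∀ θ : ℕ, 1 ≤ θ →
        (M.scale θ).IsLongRunAverageProfit (M.shipperPrice z) (M.carrierPrice z) (γSP θ)) ∧
      (∃ C : ℝ, ∀ θ : ℕ, 1 ≤ θ → (M.scale θ).fluidValue - γSP θ ≤ C * √(θ : ℝ)) ∧
      (fun θ : ℕ => 1 - γSP θ / (M.scale θ).fluidValue) =O[atTop]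
        (fun θ : ℕ => 1 / √(θ : ℝ)) ∧
      Tendsto (fun θ : ℕ => γSP θ / (M.scale θ).fluidValue) atTop (𝓝 1) := by
  have := hM.isStochastic
  obtain ⟨γSP, hγ, ⟨C, hC⟩, hO, hlim⟩ := theorem2_general M hM.arrival_pos hM.costCDF_zero
    (fun e => (hM.demand_strictAnti e).injOn) hz hpos
  exact ⟨fun θ => γSP θ, fun θ hθ => hγ θ (by positivity),
    ⟨C, fun θ hθ => (le_abs_self _).trans (hC θ (by exact_mod_cast hθ))⟩,
    hO.comp_tendsto tendsto_natCast_atTop_atTop, hlim.comp tendsto_natCast_atTop_atTop⟩
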